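/- Let $(\Omega,\mathcal F,(\mathcal F_t)_{t\ge 0},\mathbb P)$ be a filtered probability space satisfying the usual conditions, let $H$ be a separable Hilbert space (regarded as a real one), and let $T\in[0,\infty)$. Let $M$ be a real-valued square-integrable Lévy martingale, i.e. a square-integrable càdlàg $(\mathcal F_t)$-martingale with $M_0=0$ a.s. whose increments $M_t-M_s$, $s\le t$, are independent of $\mathcal F_s$ and stationary. Let $C_{\rm ad}[0,T]$ be the space of continuous curves $[0,T]\to L^2(\Omega;H)$, $t\mapsto\Phi_t$, such that $\Phi_t$ is $\mathcal F_t$-measurable for every $t\in[0,T]$. For $\Phi\in C_{\rm ad}[0,T]$, the integral $Y=(\text{G-})(\Phi\cdot M)$ is the family $(Y_t)_{t\in[0,T]}$ in $L^2(\Omega;H)$ such that for every $t\in[0,T]$ and $\varepsilon>0$ there is $\delta>0$ with $$\mathbb E\Big[\Big\|Y_t-\sum_{i=0}^{n-1}\Phi_{t_i}(M_{t_{i+1}}-M_{t_i})\Big\|^2\Big]<\varepsilon$$ for every partition $0=t_0<t_1<\dots<t_n=t$ with all $t_{i+1}-t_i<\delta$. For a predictable $H$-valued process $\Psi$ with $\mathbb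 E\int_0^T\|\Psi_t\|^2\,dt<\infty$, the Itô integral $\Psi\cdot M$ is the adapted càdlàg process on $[0,T]$ such that $(\Psi\cdot M)_t$ is, for every $t\in[0,T]$, the $L^2(\Omega;H)$-limit of the elementary integrals $\sum_i \xi_i^k(M_{v_i^k\wedge t}-M_{u_i^k\wedge t})$ of elementary predictable processes $\sum_i\xi_i^k 1_{(u_i^k,v_i^k]}$ (finite sums, $\xi_i^k$ bounded and $\mathcal F_{u_i^k}$-measurable) converging to $\Psi$ in $L^2(\Omega\times[0,T],\mathbb P\otimes dt;H)$ as $k\to\infty$. Then for every $\Phi\in C_{\rm ad}[0,T]$: 1. $\Phi$ has a predictable version, i.e. there is a predictable process ${}^p\Phi$ with ${}^p\Phi_t=\Phi_t$ a.s. for every $t\in[0,T]$. 2. $(\text{G-})(\Phi\cdot M)$ exists, is unique, and belongs to $C_{\rm ad}[0,T]$. 3. For every predictable version ${}^p\Phi$ of $\Phi$, the Itô integral ${}^p\Phi\cdot M$ exists (in particular ${}^p\Phi\in L^2(\Omega\times[0,T],\mathbb P\otimes dt;H)$), and $$(\text{G-})(\Phi\cdot M)={}^p\Phi\cdot M\quad\text{in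 }C_{\rm ad}[0,T],$$ that is, $({}^p\Phi\cdot M)_t=(\text{G-})(\Phi\cdot M)_t$ a.s. for every $t\in[0,T]$. 4. In particular, $(\text{G-})(\Phi\cdot M)$ has an adapted càdlàg version. -/

import Mathlib

open MeasureTheory ProbabilityTheory Filter Set
open scoped NNReal ENNReal Topology

namespace StochasticCurves

noncomputable section

/-- The function `x` is càdlàg on the time set `s`: at every point of `s` it is right-continuous and
has a left limit (within `s`). -/
def CadlagOn {E : Type*} [TopologicalSpace E] (x : ℝ≥0 → E) (s : Set ℝ≥0) : Prop :=
  ∀ t ∈ s, ContinuousWithinAt x (s ∩ Ici t) t ∧ ∃ l : E, Tendsto x (𝓝[s ∩ Iio t] t) (𝓝 l)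

/-- Lebesgue measure `λ` on `[0,T]`, as a measure on the time axis `ℝ≥0`. -/
def lebesgue (T : ℝ≥0) : Measure ℝ≥0 :=
  (volume.restrict (Icc (0 : ℝ) T)).map Real.toNNReal

section Basic

variable {Ω : Type*} {mΩ : MeasurableSpace Ω}

/-- The usual conditions: the filtration is right-continuous and `𝓕 0` contains every `P`-null set
(in particular `P` is complete). -/
structure UsualConditions (P : Measure Ω) (𝓕 : Filtration ℝ≥0 mΩ) : Prop where
  rightContinuous : 𝓕.IsRightContinuous
  complete : ∀ N : Set Ω, P N = 0 → MeasurableSet[𝓕 0] N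

/-- `M` is a real square-integrable Lévy martingale on the filtered space: a càdlàg
square-integrable martingale started at `0` whose increments `M t - M s` are independent of `𝓕 s`
and stationary. (Stochastic continuity follows from right-continuity of the paths and
stationarity.) -/
structure IsSqIntegrableLevyMartingale (P : Measure Ω) (𝓕 : Filtration ℝ≥0 mΩ)
    (M : ℝ≥0 → Ω → ℝ) : Prop where
  martingale : Martingale M 𝓕 P
  memLp : ∀ t, MemLp (M t) 2 P
  zero : ∀ᵐ ω ∂P, M 0 ω = 0
  indep : ∀ s t, s ≤ t →
    Indep (MeasurableSpace.comap (fun ω ↦ M t ω - M s ω) inferInstance) (𝓕 s) P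
  stationary : ∀ s h, IdentDistrib (fun ω ↦ M (s + h) ω - M s ω) (fun ω ↦ M h ω - M 0 ω) P P
  cadlag : ∀ᵐ ω ∂P, CadlagOn (fun t ↦ M t ω) univ

variable {H : Type*} [NormedAddCommGroup H]

/-- The space `C_ad[0,T]` of adapted curves in `C([0,T]; L²(Ω; H))`. -/
def Cad (P : Measure Ω) (𝓕 : Filtration ℝ≥0 mΩ) (H : Type*) [NormedAddCommGroup H] (T : ℝ≥0) :
    Set C(Icc (0 : ℝ≥0) T, Lp H 2 P) :=
  {r | ∀ t : Icc (0 : ℝ≥0) T, AEStronglyMeasurable[𝓕 t] (r t) P}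

/-- The process `Z` (of which only the values on `[0,T]` matter) is a version of the curve `r`:
`Z t = r t` almost surely for every `t ∈ [0,T]`. -/
def IsVersion {P : Measure Ω} {T : ℝ≥0} (Z : ℝ≥0 → Ω → H)
    (r : Icc (0 : ℝ≥0) T → Lp H 2 P) : Prop :=
  ∀ t : Icc (0 : ℝ≥0) T, Z t =ᵐ[P] r t

/-- The process `Ψ` belongs to `L²(𝓟_T) = L²(Ω × [0,T], 𝓟_T, P ⊗ λ; H)`. -/
def MemPredictableL2 (P : Measure Ω) (𝓕 : Filtration ℝ≥0 mΩ) (T : ℝ≥0) (Ψ : ℝ≥0 → Ω → H) :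
    Prop :=
  IsStronglyPredictable 𝓕 Ψ ∧
    ∫⁻ p, ‖Ψ p.1 p.2‖ₑ ^ 2 ∂((lebesgue T).prod P) < ∞

/-- An elementary predictable integrand `∑ i, ξ i · 1_{(u i, v i]}` with bounded `𝓕 (u i)`-measurable
`ξ i`. (A further summand carried by the time point `0` would not affect the integral.) -/
structure ElementaryProcess (𝓕 : Filtration ℝ≥0 mΩ) (H : Type*) [NormedAddCommGroup H] where
  n : ℕ
  u : Fin n → ℝ≥0
  v : Fin n → ℝ≥0
  u_le_v : ∀ i, u i ≤ v i
  ξ : Fin n → Ω → H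
  measurable_ξ : ∀ i, StronglyMeasurable[𝓕 (u i)] (ξ i)
  bounded_ξ : ∃ C : ℝ, ∀ i ω, ‖ξ i ω‖ ≤ C

/-- The process `(t, ω) ↦ ∑ i, ξ i ω · 1_{(u i, v i]} t`. -/
def ElementaryProcess.toFun {𝓕 : Filtration ℝ≥0 mΩ} (X : ElementaryProcess 𝓕 H)
    (t : ℝ≥0) (ω : Ω) : H :=
  ∑ i, (Ioc (X.u i) (X.v i)).indicator (fun _ ↦ X.ξ i ω) t

variable [NormedSpace ℝ H]

/-- The elementary stochastic integral
`(X · M) t = ∑ i, ξ i (M (v i ∧ t) - M (u i ∧ t))`. -/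
def ElementaryProcess.integral {𝓕 : Filtration ℝ≥0 mΩ} (X : ElementaryProcess 𝓕 H)
    (M : ℝ≥0 → Ω → ℝ) (t : ℝ≥0) (ω : Ω) : H :=
  ∑ i, (M (min (X.v i) t) ω - M (min (X.u i) t) ω) • X.ξ i ω

/-- The process `I` is the Itô integral `Ψ · M` on `[0,T]` of `Ψ ∈ L²(𝓟_T)` with respect to the
square-integrable Lévy martingale `M`: the adapted càdlàg process obtained by extending the
elementary integral in `L²`, that is, for some sequence (equivalently, any) of elementary integrands `X k` converging to `Ψ` in
`L²(P ⊗ λ)` the random variables `(X k · M) t` converge to `I t` in `L²` for all `t ∈ [0,T]`.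
(For a Lévy martingale `⟨M, M⟩ t` is a constant multiple of `t`, so convergence in `L²(P ⊗ λ)` is the
convergence that the Itô isometry asks for.) -/
def IsItoIntegral (P : Measure Ω) (𝓕 : Filtration ℝ≥0 mΩ) (M : ℝ≥0 → Ω → ℝ) (T : ℝ≥0)
    (Ψ I : ℝ≥0 → Ω → H) : Prop :=
  MemPredictableL2 P 𝓕 T Ψ ∧
  (∀ t ∈ Icc (0 : ℝ≥0) T, StronglyMeasurable[𝓕 t] (I t)) ∧
  (∀ ω, CadlagOn (fun t ↦ I t ω) (Icc (0 : ℝ≥0) T)) ∧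
  ∃ X : ℕ → ElementaryProcess 𝓕 H,
    Tendsto (fun k ↦ ∫⁻ p, ‖Ψ p.1 p.2 - (X k).toFun p.1 p.2‖ₑ ^ 2
      ∂((lebesgue T).prod P)) atTop (𝓝 0) ∧
    ∀ t ∈ Icc (0 : ℝ≥0) T,
      Tendsto (fun k ↦ ∫⁻ ω, ‖I t ω - (X k).integral M t ω‖ₑ ^ 2 ∂P) atTop (𝓝 0)

/-- The process `Y` is the stochastic integral `(G-)(Φ · M)`: for every `t ∈ [0,T]` and `ε > 0` there
is `δ > 0` such that `E ‖Y t - ∑ i < n, Φ (τ i) (M (τ (i+1)) - M (τ i))‖² < ε` for every partition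
`0 = τ 0 < τ 1 < ⋯ < τ n = t` of mesh smaller than `δ`. -/
def IsGIntegral {P : Measure Ω} {T : ℝ≥0} (M : ℝ≥0 → Ω → ℝ)
    (Φ Y : Icc (0 : ℝ≥0) T → Lp H 2 P) : Prop :=
  ∀ t : Icc (0 : ℝ≥0) T, ∀ ε : ℝ, 0 < ε → ∃ δ : ℝ, 0 < δ ∧
    ∀ (n : ℕ) (τ : Fin (n + 1) → Icc (0 : ℝ≥0) T), StrictMono τ →
      ((τ 0 : ℝ≥0) = 0) → τ (Fin.last n) = t →
      (∀ i : Fin n, ((τ i.succ : ℝ≥0) : ℝ) - ((τ i.castSucc : ℝ≥0) : ℝ) < δ) →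
      ∫⁻ ω, ‖Y t ω - ∑ i : Fin n,
        (M (τ i.succ) ω - M (τ i.castSucc) ω) • Φ (τ i.castSucc) ω‖ₑ ^ 2 ∂P < ENNReal.ofReal ε

end Basic

end

end StochasticCurves

/-! Write σ² for `varianceRate`. Increments are stationary and orthogonal, so E(M_t − M_0)² is
additive in t and hence equals σ²t. Independence of the past then gives E⟨(M_v − M_u)ξ, (M_v' −
M_u')η⟩ = σ² λ((u,v] ∩ (u',v']) E⟨ξ,η⟩. Integrating step curves is therefore, up to the factor σ, an
isometry from L²([0,T]; L²(Ω;H)) into L²(Ω;H) (`inner_stepGraph`), and this survives on the closure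
of its graph (`HasCurveIntegral`). With the graph in place of an operator, well-definedness is a
consequence of the isometry and not a prerequisite.

Both integrals of the theorem are compared with this curve integral. A Riemann sum is the integral
of a left-point step curve. Since Φ is uniformly continuous on the compact [0,T], that curve is
uniformly close to 1_{[0,t]}Φ for small mesh, so the sums converge to the curve integral
(`isGIntegral_of_hasCurveIntegral`). By Tonelli, elementary processes converge to a predictable
version in L²(λ ⊗ P) exactly when their curves converge to Φ, so the Itô integral has the same value
(`IsItoIntegral.isVersion`).

The pathwise claims rest on uniform approximation of Φ by elementary processes at rate 4^{-k}
(`exists_elementary_near`). At this rate the processes converge almost surely at each fixed positive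
time, which yields the predictable version. Doob's inequality and Borel–Cantelli make the elementary
integrals converge uniformly on [0,T] almost surely, so the limit is càdlàg; the usual conditions
absorb the exceptional null set. -/

set_option linter.unusedSectionVars false

namespace StochasticCurves

/-! ### Second moments of the increments of the Lévy martingale. -/

section Increments

variable {Ω : Type*} {mΩ : MeasurableSpace Ω} {P : Measure Ω} [IsProbabilityMeasure P]
  {𝓕 : Filtration ℝ≥0 mΩ} {M : ℝ≥0 → Ω → ℝ}

namespace IsSqIntegrableLevyMartingale

lemma memLp_increment (hM : IsSqIntegrableLevyMartingale P 𝓕 M) (a b : ℝ≥0) :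
    MemLp (fun ω ↦ M b ω - M a ω) 2 P :=
  (hM.memLp b).sub (hM.memLp a)

lemma aestronglyMeasurable_increment (hM : IsSqIntegrableLevyMartingale P 𝓕 M) {a b c : ℝ≥0}
    (hac : a ≤ c) (hbc : b ≤ c) :
    AEStronglyMeasurable[𝓕 c] (fun ω ↦ M b ω - M a ω) P :=
  (((hM.martingale.stronglyAdapted b).mono (𝓕.mono hbc)).sub
    ((hM.martingale.stronglyAdapted a).mono (𝓕.mono hac))).aestronglyMeasurable

lemma integral_increment (hM : IsSqIntegrableLevyMartingale P 𝓕 M) {a b : ℝ≥0} (hab : a ≤ b) :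
    ∫ ω, M b ω - M a ω ∂P = 0 := by
  rw [integral_sub ((hM.memLp b).integrable (by norm_num)) ((hM.memLp a).integrable (by norm_num))]
  have := hM.martingale.setIntegral_eq hab (s := univ) MeasurableSet.univ
  simp only [Measure.restrict_univ] at this
  rw [this, sub_self]

/-- Independence of the past factorizes the expectation. With φ the identity or the square, this is
the source of every moment formula below; `f` is only a.e. measurable, hence the passage to a
representative. -/
lemma integrable_mul_comp_increment_and_integral (hM : IsSqIntegrableLevyMartingale P 𝓕 M)
    {a b : ℝ≥0} (hab : a ≤ b) {f : Ω → ℝ} (hf : AEStronglyMeasurable[𝓕 a] f P)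
    (hfi : Integrable f P) {φ : ℝ → ℝ} (hφ : Measurable φ)
    (hφi : Integrable (fun ω ↦ φ (M b ω - M a ω)) P) :
    Integrable (fun ω ↦ f ω * φ (M b ω - M a ω)) P ∧
      ∫ ω, f ω * φ (M b ω - M a ω) ∂P = (∫ ω, f ω ∂P) * ∫ ω, φ (M b ω - M a ω) ∂P := by
  obtain ⟨g, hg, hfg⟩ := hf
  have hind : g ⟂ᵢ[P] (fun ω ↦ M b ω - M a ω) := by
    rw [IndepFun_iff_Indep]
    exact indep_of_indep_of_le_left (hM.indep a b hab).symm hg.measurable.comap_le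
  have hind' : g ⟂ᵢ[P] (fun ω ↦ φ (M b ω - M a ω)) := hind.comp measurable_id hφ
  have hgi : Integrable g P := hfi.congr hfg
  have heq : (fun ω ↦ f ω * φ (M b ω - M a ω)) =ᵐ[P] g * (fun ω ↦ φ (M b ω - M a ω)) := by
    filter_upwards [hfg] with ω hω
    simp [hω]
  refine ⟨(hind'.integrable_mul hgi hφi).congr heq.symm, ?_⟩
  rw [integral_congr_ae heq, hind'.integral_mul_eq_mul_integral hgi.1 hφi.1,
    integral_congr_ae hfg]

lemma integrable_mul_increment (hM : IsSqIntegrableLevyMartingale P 𝓕 M)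
    {a b : ℝ≥0} (hab : a ≤ b) {f : Ω → ℝ} (hf : AEStronglyMeasurable[𝓕 a] f P)
    (hfi : Integrable f P) : Integrable (fun ω ↦ f ω * (M b ω - M a ω)) P :=
  (hM.integrable_mul_comp_increment_and_integral hab hf hfi measurable_id
    ((hM.memLp_increment a b).integrable (by norm_num))).1

lemma integral_mul_increment (hM : IsSqIntegrableLevyMartingale P 𝓕 M)
    {a b : ℝ≥0} (hab : a ≤ b) {f : Ω → ℝ} (hf : AEStronglyMeasurable[𝓕 a] f P)
    (hfi : Integrable f P) : ∫ ω, f ω * (M b ω - M a ω) ∂P = 0 := by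
  have := (hM.integrable_mul_comp_increment_and_integral hab hf hfi measurable_id
    ((hM.memLp_increment a b).integrable (by norm_num))).2
  simp only [id] at this
  rw [this, hM.integral_increment hab, mul_zero]

lemma integrable_mul_sq_increment (hM : IsSqIntegrableLevyMartingale P 𝓕 M)
    {a b : ℝ≥0} (hab : a ≤ b) {f : Ω → ℝ} (hf : AEStronglyMeasurable[𝓕 a] f P)
    (hfi : Integrable f P) : Integrable (fun ω ↦ f ω * (M b ω - M a ω) ^ 2) P :=
  (hM.integrable_mul_comp_increment_and_integral hab hf hfi (measurable_id.pow_const 2)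
    (hM.memLp_increment a b).integrable_sq).1

end IsSqIntegrableLevyMartingale

/-- A nonnegative additive function on `ℝ≥0` is linear. -/
lemma eq_mul_one_of_additive {v : ℝ≥0 → ℝ} (hv : ∀ t, 0 ≤ v t)
    (hadd : ∀ s t, v (s + t) = v s + v t) (t : ℝ≥0) : v t = t * v 1 := by
  have hmono : Monotone v := fun s t hst ↦ by
    obtain ⟨r, rfl⟩ := exists_add_of_le hst
    rw [hadd]
    linarith [hv r]
  have h0 : v 0 = 0 := by
    have := hadd 0 0
    simp at this
    exact this
  have hnat : ∀ (n : ℕ) (s : ℝ≥0), v (n * s) = n * v s := by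
    intro n s
    induction n with
    | zero => simp [h0]
    | succ n ih =>
      push_cast
      rw [add_mul, hadd, ih]
      simp
      ring
  have hfloor : ∀ s : ℝ≥0, |v s - s * v 1| ≤ v 1 := by
    intro s
    have h1 : v (⌊s⌋₊ : ℝ≥0) ≤ v s := hmono (Nat.floor_le (zero_le))
    have h2 : v s ≤ v ((⌊s⌋₊ : ℝ≥0) + 1) := hmono (Nat.lt_floor_add_one s).le
    have h3 : v (⌊s⌋₊ : ℝ≥0) = ⌊s⌋₊ * v 1 := by simpa using hnat ⌊s⌋₊ 1
    rw [hadd] at h2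
    have h4 : ((⌊s⌋₊ : ℝ)) ≤ s := by exact_mod_cast Nat.floor_le (zero_le)
    have h5 : (s : ℝ) ≤ (⌊s⌋₊ : ℝ) + 1 := by exact_mod_cast (Nat.lt_floor_add_one s).le
    have h6 := hv 1
    rw [abs_le]
    constructor <;> nlinarith
  -- The bound in `hfloor` does not depend on s. At n * t the left side is n times the error at t,
  -- which forces that error to vanish.
  have hlim : ∀ n : ℕ, (n : ℝ) * |v t - t * v 1| ≤ v 1 := by
    intro n
    have := hfloor (n * t)
    rw [hnat] at this
    push_cast at this
    rwa [mul_assoc, ← mul_sub, abs_mul, Nat.abs_cast] at this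
  by_contra hne
  have hpos : 0 < |v t - t * v 1| := abs_pos.2 (sub_ne_zero.2 hne)
  obtain ⟨n, hn⟩ := exists_nat_gt (v 1 / |v t - t * v 1|)
  rw [div_lt_iff₀ hpos] at hn
  exact absurd (hlim n) (not_le.2 hn)

/-- The variance of the Lévy martingale at time `1`. -/
noncomputable def varianceRate (P : Measure Ω) (M : ℝ≥0 → Ω → ℝ) : ℝ :=
  ∫ ω, (M 1 ω - M 0 ω) ^ 2 ∂P

lemma varianceRate_nonneg (P : Measure Ω) (M : ℝ≥0 → Ω → ℝ) : 0 ≤ varianceRate P M :=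
  integral_nonneg fun _ ↦ sq_nonneg _

namespace IsSqIntegrableLevyMartingale

lemma integral_sq_increment_add (hM : IsSqIntegrableLevyMartingale P 𝓕 M) (s h : ℝ≥0) :
    ∫ ω, (M (s + h) ω - M s ω) ^ 2 ∂P = ∫ ω, (M h ω - M 0 ω) ^ 2 ∂P :=
  ((hM.stationary s h).comp (measurable_id.pow_const 2)).integral_eq

/-- The second moment is additive because the cross term vanishes and increments are stationary; a
nonnegative additive function is linear. -/
lemma integral_sq_increment (hM : IsSqIntegrableLevyMartingale P 𝓕 M) {a b : ℝ≥0} (hab : a ≤ b) :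
    ∫ ω, (M b ω - M a ω) ^ 2 ∂P = varianceRate P M * (b - a) := by
  have hlin := eq_mul_one_of_additive (v := fun t ↦ ∫ ω, (M t ω - M 0 ω) ^ 2 ∂P)
    (fun t ↦ integral_nonneg fun _ ↦ sq_nonneg _) (fun s t ↦ by
      have hcross : ∫ ω, (M s ω - M 0 ω) * (M (s + t) ω - M s ω) ∂P = 0 :=
        hM.integral_mul_increment le_self_add
          (hM.aestronglyMeasurable_increment (zero_le) le_rfl)
          ((hM.memLp_increment 0 s).integrable (by norm_num))
      have hcross_int : Integrable (fun ω ↦ (M s ω - M 0 ω) * (M (s + t) ω - M s ω)) P :=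
        hM.integrable_mul_increment le_self_add
          (hM.aestronglyMeasurable_increment (zero_le) le_rfl)
          ((hM.memLp_increment 0 s).integrable (by norm_num))
      calc ∫ ω, (M (s + t) ω - M 0 ω) ^ 2 ∂P
          = ∫ ω, ((M s ω - M 0 ω) ^ 2 + (M (s + t) ω - M s ω) ^ 2)
              + 2 * ((M s ω - M 0 ω) * (M (s + t) ω - M s ω)) ∂P := by
            congr 1 with ω
            ring
        _ = _ := by
            rw [integral_add (f := fun ω ↦ (M s ω - M 0 ω) ^ 2 + (M (s + t) ω - M s ω) ^ 2)
              ((hM.memLp_increment 0 s).integrable_sq.add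
              (hM.memLp_increment s (s + t)).integrable_sq) (hcross_int.const_mul 2),
              integral_add (hM.memLp_increment 0 s).integrable_sq
              (hM.memLp_increment s (s + t)).integrable_sq, integral_const_mul, hcross,
              hM.integral_sq_increment_add]
            ring)
  obtain ⟨h, rfl⟩ := exists_add_of_le hab
  rw [hM.integral_sq_increment_add, hlin h, varianceRate]
  push_cast
  ring

lemma integral_mul_sq_increment (hM : IsSqIntegrableLevyMartingale P 𝓕 M)
    {a b : ℝ≥0} (hab : a ≤ b) {f : Ω → ℝ} (hf : AEStronglyMeasurable[𝓕 a] f P)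
    (hfi : Integrable f P) :
    ∫ ω, f ω * (M b ω - M a ω) ^ 2 ∂P = varianceRate P M * (b - a) * ∫ ω, f ω ∂P := by
  have := (hM.integrable_mul_comp_increment_and_integral hab hf hfi (measurable_id.pow_const 2)
    (hM.memLp_increment a b).integrable_sq).2
  simp only [id] at this
  rw [this, hM.integral_sq_increment hab, mul_comm]

/-- Conditional covariance of two increments that start at the same time. -/
lemma integral_mul_increment_mul_increment_of_le (hM : IsSqIntegrableLevyMartingale P 𝓕 M)
    {a b b' : ℝ≥0} (hab : a ≤ b) (hbb : b ≤ b') {f : Ω → ℝ}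
    (hf : AEStronglyMeasurable[𝓕 a] f P) (hfi : Integrable f P) :
    Integrable (fun ω ↦ f ω * (M b ω - M a ω) * (M b' ω - M a ω)) P ∧
    ∫ ω, f ω * (M b ω - M a ω) * (M b' ω - M a ω) ∂P
      = varianceRate P M * (b - a) * ∫ ω, f ω ∂P := by
  have hg : AEStronglyMeasurable[𝓕 b] (fun ω ↦ f ω * (M b ω - M a ω)) P :=
    (hf.mono (𝓕.mono hab)).mul (hM.aestronglyMeasurable_increment hab le_rfl)
  have hgi := hM.integrable_mul_increment hab hf hfi
  have heq : (fun ω ↦ f ω * (M b ω - M a ω) * (M b' ω - M a ω)) = fun ω ↦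
      f ω * (M b ω - M a ω) * (M b' ω - M b ω) + f ω * (M b ω - M a ω) ^ 2 := by
    ext ω
    ring
  rw [heq]
  refine ⟨(hM.integrable_mul_increment hbb hg hgi).add (hM.integrable_mul_sq_increment hab hf hfi),
    ?_⟩
  rw [integral_add (hM.integrable_mul_increment hbb hg hgi)
    (hM.integrable_mul_sq_increment hab hf hfi), hM.integral_mul_increment hbb hg hgi,
    hM.integral_mul_sq_increment hab hf hfi, zero_add]

lemma integral_mul_increment_mul_increment (hM : IsSqIntegrableLevyMartingale P 𝓕 M)
    {a b b' : ℝ≥0} (hab : a ≤ b) (hab' : a ≤ b') {f : Ω → ℝ}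
    (hf : AEStronglyMeasurable[𝓕 a] f P) (hfi : Integrable f P) :
    Integrable (fun ω ↦ f ω * (M b ω - M a ω) * (M b' ω - M a ω)) P ∧
    ∫ ω, f ω * (M b ω - M a ω) * (M b' ω - M a ω) ∂P
      = varianceRate P M * ((min b b' : ℝ≥0) - a) * ∫ ω, f ω ∂P := by
  rcases le_total b b' with h | h
  · rw [min_eq_left h]
    exact hM.integral_mul_increment_mul_increment_of_le hab h hf hfi
  · rw [min_eq_right h]
    have heq : (fun ω ↦ f ω * (M b ω - M a ω) * (M b' ω - M a ω)) = fun ω ↦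
        f ω * (M b' ω - M a ω) * (M b ω - M a ω) := by
      ext ω
      ring
    rw [heq]
    exact hM.integral_mul_increment_mul_increment_of_le hab' h hf hfi

end IsSqIntegrableLevyMartingale

variable {H : Type*} [NormedAddCommGroup H] [InnerProductSpace ℝ H]

lemma integrable_inner_of_memLp {f g : Ω → H} (hf : MemLp f 2 P) (hg : MemLp g 2 P) :
    Integrable (fun ω ↦ inner ℝ (f ω) (g ω)) P :=
  (hf.norm.integrable_mul hg.norm).mono' (hf.1.inner hg.1)
    (Eventually.of_forall fun _ ↦ norm_inner_le_norm _ _)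

namespace IsSqIntegrableLevyMartingale

/-- E(‖ξ‖² (M_v − M_u)²) factorizes by independence, so square integrability of ξ suffices and no
bound on it is needed. -/
lemma memLp_increment_smul (hM : IsSqIntegrableLevyMartingale P 𝓕 M) {u v : ℝ≥0} (huv : u ≤ v)
    {ξ : Ω → H} (hξ : AEStronglyMeasurable[𝓕 u] ξ P) (hξ2 : MemLp ξ 2 P) :
    MemLp (fun ω ↦ (M v ω - M u ω) • ξ ω) 2 P := by
  refine (memLp_two_iff_integrable_sq_norm ((hM.memLp_increment u v).1.smul hξ2.1)).2 ?_
  have h := hM.integrable_mul_sq_increment huv (f := fun ω ↦ ‖ξ ω‖ ^ 2)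
    ((continuous_norm.pow 2).comp_aestronglyMeasurable hξ) ((memLp_two_iff_integrable_sq_norm hξ2.1).1 hξ2)
  refine h.congr (Eventually.of_forall fun ω ↦ ?_)
  simp [norm_smul, mul_pow, mul_comm]

lemma integral_inner_increment_smul_of_le (hM : IsSqIntegrableLevyMartingale P 𝓕 M)
    {u v u' v' : ℝ≥0} (huv : u ≤ v) (huv' : u' ≤ v') (huu : u ≤ u') {ξ η : Ω → H}
    (hξ : AEStronglyMeasurable[𝓕 u] ξ P) (hξ2 : MemLp ξ 2 P)
    (hη : AEStronglyMeasurable[𝓕 u'] η P) (hη2 : MemLp η 2 P) :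
    ∫ ω, inner ℝ ((M v ω - M u ω) • ξ ω) ((M v' ω - M u' ω) • η ω) ∂P
      = varianceRate P M * ((min v v' - u' : ℝ≥0) : ℝ) * ∫ ω, inner ℝ (ξ ω) (η ω) ∂P := by
  have hf : AEStronglyMeasurable[𝓕 u'] (fun ω ↦ inner ℝ (ξ ω) (η ω)) P :=
    (hξ.mono (𝓕.mono huu)).inner hη
  have hfi : Integrable (fun ω ↦ inner ℝ (ξ ω) (η ω)) P := integrable_inner_of_memLp hξ2 hη2
  have hmin : u ≤ min v u' := le_min huv huu
  have hg : AEStronglyMeasurable[𝓕 u']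
      (fun ω ↦ inner ℝ ((M (min v u') ω - M u ω) • ξ ω) (η ω)) P :=
    ((hM.aestronglyMeasurable_increment huu (min_le_right _ _)).smul
      (hξ.mono (𝓕.mono huu))).inner hη
  have hgi : Integrable (fun ω ↦ inner ℝ ((M (min v u') ω - M u ω) • ξ ω) (η ω)) P :=
    integrable_inner_of_memLp (hM.memLp_increment_smul hmin hξ hξ2) hη2
  have hcov := hM.integral_mul_increment_mul_increment (le_max_right v u') huv' hf hfi
  -- The first increment is cut at u'. The part before u' belongs to the past and pairs to zero with
  -- the second increment; the part after u' starts where the second increment starts. `min` and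
  -- `max` treat v ≤ u' and u' ≤ v together.
  have heq : (fun ω ↦ inner ℝ ((M v ω - M u ω) • ξ ω) ((M v' ω - M u' ω) • η ω)) = fun ω ↦
      inner ℝ ((M (min v u') ω - M u ω) • ξ ω) (η ω) * (M v' ω - M u' ω)
      + inner ℝ (ξ ω) (η ω) * (M (max v u') ω - M u' ω) * (M v' ω - M u' ω) := by
    ext ω
    simp only [inner_smul_left, inner_smul_right, conj_trivial]
    rcases le_total v u' with h | h
    · rw [min_eq_left h, max_eq_right h]
      ring
    · rw [min_eq_right h, max_eq_left h]
      ring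
  rw [heq, integral_add (hM.integrable_mul_increment huv' hg hgi) hcov.1,
    hM.integral_mul_increment huv' hg hgi, hcov.2, zero_add]
  congr 2
  -- If v ≤ u' the intervals do not overlap, and truncated subtraction yields the required 0.
  rw [NNReal.coe_sub_def]
  rcases le_total v u' with h | h
  · rw [max_eq_right h, min_eq_left huv', min_eq_left (h.trans huv'), max_eq_right, sub_self]
    rw [sub_nonpos]
    exact_mod_cast h
  · rw [max_eq_left h, max_eq_left]
    rw [sub_nonneg]
    exact_mod_cast le_min h huv'

lemma integral_inner_increment_smul (hM : IsSqIntegrableLevyMartingale P 𝓕 M)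
    {u v u' v' : ℝ≥0} (huv : u ≤ v) (huv' : u' ≤ v') {ξ η : Ω → H}
    (hξ : AEStronglyMeasurable[𝓕 u] ξ P) (hξ2 : MemLp ξ 2 P)
    (hη : AEStronglyMeasurable[𝓕 u'] η P) (hη2 : MemLp η 2 P) :
    ∫ ω, inner ℝ ((M v ω - M u ω) • ξ ω) ((M v' ω - M u' ω) • η ω) ∂P
      = varianceRate P M * ((min v v' - max u u' : ℝ≥0) : ℝ) * ∫ ω, inner ℝ (ξ ω) (η ω) ∂P := by
  rcases le_total u u' with h | h
  · rw [max_eq_right h]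
    exact hM.integral_inner_increment_smul_of_le huv huv' h hξ hξ2 hη hη2
  · rw [max_eq_left h, min_comm]
    simp_rw [real_inner_comm ((M v' _ - M u' _) • η _), real_inner_comm (η _)]
    exact hM.integral_inner_increment_smul_of_le huv' huv h hη hη2 hξ hξ2

/-- Increments after time `a` are orthogonal to the past. -/
lemma integral_inner_increment_smul_eq_zero (hM : IsSqIntegrableLevyMartingale P 𝓕 M)
    {a b : ℝ≥0} (hab : a ≤ b) {ξ η : Ω → H}
    (hξ : AEStronglyMeasurable[𝓕 a] ξ P) (hξ2 : MemLp ξ 2 P)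
    (hη : AEStronglyMeasurable[𝓕 a] η P) (hη2 : MemLp η 2 P) :
    ∫ ω, inner ℝ (ξ ω) ((M b ω - M a ω) • η ω) ∂P = 0 := by
  have := hM.integral_mul_increment hab (hξ.inner hη) (integrable_inner_of_memLp hξ2 hη2)
  simpa [inner_smul_right, mul_comm] using this

end IsSqIntegrableLevyMartingale

end Increments

/-! ### Lebesgue measure on the time axis. -/

section Lebesgue

instance isFiniteMeasure_lebesgue (T : ℝ≥0) : IsFiniteMeasure (lebesgue T) := by
  unfold lebesgue
  infer_instance

lemma lebesgue_Ioc {T a b : ℝ≥0} (hb : b ≤ T) : lebesgue T (Ioc a b) = ((b - a : ℝ≥0) : ℝ≥0∞) := by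
  rw [lebesgue, Measure.map_apply measurable_real_toNNReal measurableSet_Ioc,
    Measure.restrict_apply (measurable_real_toNNReal measurableSet_Ioc)]
  have : Real.toNNReal ⁻¹' Ioc a b ∩ Icc (0 : ℝ) T = Ioc (a : ℝ) b := by
    ext x
    simp only [mem_inter_iff, mem_preimage, mem_Ioc, mem_Icc, Real.lt_toNNReal_iff_coe_lt,
      Real.toNNReal_le_iff_le_coe]
    constructor
    · rintro ⟨h, -⟩
      exact h
    · rintro ⟨h1, h2⟩
      exact ⟨⟨h1, h2⟩, a.2.trans h1.le, h2.trans (by exact_mod_cast hb)⟩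
  rw [this, Real.volume_Ioc, NNReal.sub_def, ENNReal.ofReal]

/-- Time 0 must be discarded, since step functions on half-open intervals vanish there and cannot
approximate Φ at 0. -/
lemma ae_lebesgue_mem_Ioc (T : ℝ≥0) : ∀ᵐ s ∂lebesgue T, s ∈ Ioc 0 T := by
  rw [lebesgue, ae_map_iff (p := fun s ↦ s ∈ Ioc 0 T)
    measurable_real_toNNReal.aemeasurable measurableSet_Ioc,
    ← Measure.restrict_congr_set Ioc_ae_eq_Icc]
  filter_upwards [ae_restrict_mem measurableSet_Ioc] with x hx
  simpa [Real.toNNReal_le_iff_le_coe] using hx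

end Lebesgue

/-! ### The isometry on step curves and its extension to the closure of the graph. -/

section Graph

variable {Ω : Type*} {mΩ : MeasurableSpace Ω} {P : Measure Ω} [IsProbabilityMeasure P]
  {𝓕 : Filtration ℝ≥0 mΩ} {M : ℝ≥0 → Ω → ℝ}
  {H : Type*} [NormedAddCommGroup H] [InnerProductSpace ℝ H] [CompleteSpace H] {T : ℝ≥0}

/-- The graph of the stochastic integral on step curves in `L²([0,T]; L²(P; H))`. -/
noncomputable def stepGraph (P : Measure Ω) (𝓕 : Filtration ℝ≥0 mΩ) (M : ℝ≥0 → Ω → ℝ) (H : Type*)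
    [NormedAddCommGroup H] [InnerProductSpace ℝ H] (T : ℝ≥0) :
    Submodule ℝ (Lp (Lp H 2 P) 2 (lebesgue T) × Lp H 2 P) :=
  Submodule.span ℝ {p | ∃ (u v : ℝ≥0) (ξ : Lp H 2 P), u ≤ v ∧ v ≤ T ∧
    AEStronglyMeasurable[𝓕 u] ξ P ∧
    p.1 = indicatorConstLp 2 (measurableSet_Ioc (a := u) (b := v)) (measure_ne_top _ _) ξ ∧
    p.2 =ᵐ[P] fun ω ↦ (M v ω - M u ω) • ξ ω}

/-- Both sides are bilinear, so generators suffice; there λ((u,v] ∩ (u',v']) is the overlap factor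
in `integral_inner_increment_smul`. -/
lemma inner_stepGraph (hM : IsSqIntegrableLevyMartingale P 𝓕 M)
    {p q : Lp (Lp H 2 P) 2 (lebesgue T) × Lp H 2 P}
    (hp : p ∈ stepGraph P 𝓕 M H T) (hq : q ∈ stepGraph P 𝓕 M H T) :
    inner ℝ p.2 q.2 = varianceRate P M * inner ℝ p.1 q.1 := by
  refine Submodule.span_induction₂ (p := fun p q _ _ ↦
    inner ℝ p.2 q.2 = varianceRate P M * inner ℝ p.1 q.1) ?_ ?_ ?_ ?_ ?_ ?_ ?_ hp hq
  · rintro p q ⟨u, v, ξ, huv, hvT, hξ, hp1, hp2⟩ ⟨u', v', η, huv', hvT', hη, hq1, hq2⟩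
    rw [hp1, hq1, L2.inner_indicatorConstLp_indicatorConstLp, Ioc_inter_Ioc, L2.inner_def,
      L2.inner_def, measureReal_def, lebesgue_Ioc ((min_le_left _ _).trans hvT),
      ENNReal.coe_toReal, smul_eq_mul, ← mul_assoc]
    refine Eq.trans (integral_congr_ae ?_) (hM.integral_inner_increment_smul huv huv' hξ
      (Lp.memLp ξ) hη (Lp.memLp η))
    filter_upwards [hp2, hq2] with ω h1 h2
    rw [h1, h2]
  · intro q _
    simp
  · intro p _
    simp
  · intro p q r _ _ _ h1 h2
    simp only [Prod.fst_add, Prod.snd_add, inner_add_left, h1, h2]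
    ring
  · intro p q r _ _ _ h1 h2
    simp only [Prod.fst_add, Prod.snd_add, inner_add_right, h1, h2]
    ring
  · intro a p q _ _ h
    simp only [Prod.smul_fst, Prod.smul_snd, inner_smul_left, h]
    ring
  · intro a p q _ _ h
    simp only [Prod.smul_fst, Prod.smul_snd, inner_smul_right, h]
    ring

lemma norm_sq_closure_stepGraph (hM : IsSqIntegrableLevyMartingale P 𝓕 M)
    {p : Lp (Lp H 2 P) 2 (lebesgue T) × Lp H 2 P}
    (hp : p ∈ (stepGraph P 𝓕 M H T).topologicalClosure) :
    ‖p.2‖ ^ 2 = varianceRate P M * ‖p.1‖ ^ 2 := by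
  have hclosed : IsClosed {p : Lp (Lp H 2 P) 2 (lebesgue T) × Lp H 2 P |
      ‖p.2‖ ^ 2 = varianceRate P M * ‖p.1‖ ^ 2} :=
    isClosed_eq (by fun_prop) (by fun_prop)
  refine closure_minimal (fun q hq ↦ ?_) hclosed hp
  have := inner_stepGraph hM hq hq
  rwa [real_inner_self_eq_norm_sq, real_inner_self_eq_norm_sq] at this

/-- `A` is the stochastic integral over `[0,T]` of the curve `g` in `L²(P; H)`, in the sense of the
closure of the integral of step curves. -/
def HasCurveIntegral (P : Measure Ω) (𝓕 : Filtration ℝ≥0 mΩ) (M : ℝ≥0 → Ω → ℝ) (T : ℝ≥0)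
    (g : ℝ≥0 → Lp H 2 P) (A : Lp H 2 P) : Prop :=
  ∃ h : MemLp g 2 (lebesgue T), (h.toLp g, A) ∈ (stepGraph P 𝓕 M H T).topologicalClosure

namespace HasCurveIntegral

lemma indicator_Ioc {u v : ℝ≥0} (huv : u ≤ v) (hvT : v ≤ T) {ξ A : Lp H 2 P}
    (hξ : AEStronglyMeasurable[𝓕 u] ξ P) (hA : A =ᵐ[P] fun ω ↦ (M v ω - M u ω) • ξ ω) :
    HasCurveIntegral P 𝓕 M T ((Ioc u v).indicator fun _ ↦ ξ) A :=
  ⟨memLp_indicator_const 2 measurableSet_Ioc ξ (Or.inr (measure_ne_top _ _)),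
    subset_closure (Submodule.subset_span ⟨u, v, ξ, huv, hvT, hξ, rfl, hA⟩)⟩

lemma zero : HasCurveIntegral P 𝓕 M T (fun _ ↦ (0 : Lp H 2 P)) 0 := by
  refine ⟨MemLp.zero', ?_⟩
  have : (MemLp.zero' : MemLp (fun _ : ℝ≥0 ↦ (0 : Lp H 2 P)) 2 (lebesgue T)).toLp _ = 0 :=
    MemLp.toLp_zero _
  rw [this]
  exact Submodule.zero_mem _

lemma add {g h : ℝ≥0 → Lp H 2 P} {A B : Lp H 2 P} (hg : HasCurveIntegral P 𝓕 M T g A)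
    (hh : HasCurveIntegral P 𝓕 M T h B) :
    HasCurveIntegral P 𝓕 M T (fun s ↦ g s + h s) (A + B) := by
  obtain ⟨hg1, hg2⟩ := hg
  obtain ⟨hh1, hh2⟩ := hh
  refine ⟨hg1.add hh1, ?_⟩
  exact Submodule.add_mem _ hg2 hh2

lemma sum {ι : Type*} (S : Finset ι) {g : ι → ℝ≥0 → Lp H 2 P} {A : ι → Lp H 2 P}
    (hg : ∀ i ∈ S, HasCurveIntegral P 𝓕 M T (g i) (A i)) :
    HasCurveIntegral P 𝓕 M T (fun s ↦ ∑ i ∈ S, g i s) (∑ i ∈ S, A i) := by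
  classical
  induction S using Finset.induction_on with
  | empty => simpa using zero
  | insert a S ha ih =>
    simp_rw [Finset.sum_insert ha]
    exact (hg a (Finset.mem_insert_self _ _)).add
      (ih fun i hi ↦ hg i (Finset.mem_insert_of_mem hi))

/-- The difference of two pairs stays in the closed subspace, where the isometry applies. In
particular the integral is determined by the integrand. -/
lemma enorm_sub (hM : IsSqIntegrableLevyMartingale P 𝓕 M) {g h : ℝ≥0 → Lp H 2 P}
    {A B : Lp H 2 P} (hg : HasCurveIntegral P 𝓕 M T g A) (hh : HasCurveIntegral P 𝓕 M T h B) :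
    ‖A - B‖ₑ = ENNReal.ofReal √(varianceRate P M) * eLpNorm (g - h) 2 (lebesgue T) := by
  obtain ⟨hg1, hg2⟩ := hg
  obtain ⟨hh1, hh2⟩ := hh
  have key := norm_sq_closure_stepGraph hM (Submodule.sub_mem _ hg2 hh2)
  simp only [Prod.mk_sub_mk] at key
  rw [← MemLp.toLp_sub] at key
  have hreal : ‖A - B‖ = √(varianceRate P M) * ‖(hg1.sub hh1).toLp (g - h)‖ := by
    rw [← Real.sqrt_sq (norm_nonneg (A - B)), key, Real.sqrt_mul (varianceRate_nonneg P M),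
      Real.sqrt_sq (norm_nonneg _)]
  rw [← ofReal_norm, hreal, ENNReal.ofReal_mul (Real.sqrt_nonneg _), ofReal_norm,
    Lp.enorm_toLp]

/-- By the isometry the integrals are Cauchy along with the integrands, and the limiting pair stays
in the closed graph. -/
lemma exists_of_tendsto (hM : IsSqIntegrableLevyMartingale P 𝓕 M)
    {g : ℕ → ℝ≥0 → Lp H 2 P} {A : ℕ → Lp H 2 P}
    (hg : ∀ k, HasCurveIntegral P 𝓕 M T (g k) (A k)) {f : ℝ≥0 → Lp H 2 P}
    (hf : MemLp f 2 (lebesgue T))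
    (hlim : Tendsto (fun k ↦ eLpNorm (g k - f) 2 (lebesgue T)) atTop (𝓝 0)) :
    ∃ B, HasCurveIntegral P 𝓕 M T f B := by
  have hlimLp : Tendsto (fun k ↦ (hg k).1.toLp (g k)) atTop (𝓝 (hf.toLp f)) :=
    (Lp.tendsto_Lp_iff_tendsto_eLpNorm'' g (fun k ↦ (hg k).1) f hf).2 hlim
  have hdist : ∀ k l, dist (A k) (A l)
      = √(varianceRate P M) * dist ((hg k).1.toLp (g k)) ((hg l).1.toLp (g l)) := by
    intro k l
    have key := norm_sq_closure_stepGraph hM (Submodule.sub_mem _ (hg k).2 (hg l).2)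
    simp only [Prod.mk_sub_mk] at key
    rw [dist_eq_norm, dist_eq_norm, ← Real.sqrt_sq (norm_nonneg (A k - A l)), key,
      Real.sqrt_mul (varianceRate_nonneg P M), Real.sqrt_sq (norm_nonneg _)]
  have hcauchy : CauchySeq A := by
    rw [cauchySeq_iff_tendsto_dist_atTop_0]
    have h0 := (cauchySeq_iff_tendsto_dist_atTop_0.1 hlimLp.cauchySeq).const_mul
      √(varianceRate P M)
    rw [mul_zero] at h0
    refine h0.congr fun n ↦ (hdist n.1 n.2).symm
  obtain ⟨B, hB⟩ := cauchySeq_tendsto_of_complete hcauchy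
  refine ⟨B, hf, ?_⟩
  exact (stepGraph P 𝓕 M H T).isClosed_topologicalClosure.mem_of_tendsto
    (hlimLp.prodMk_nhds hB) (Eventually.of_forall fun k ↦ (hg k).2)

end HasCurveIntegral

end Graph

/-! ### Partitions, left-point step functions and uniform grids. -/

section Partition

/-- The half-open intervals of a partition `τ 0 ≤ ⋯ ≤ τ n` are disjoint and cover
`(τ 0, τ n]`. -/
lemma exists_unique_mem_Ioc_partition {n : ℕ} {τ : Fin (n + 1) → ℝ≥0} (hτ : Monotone τ)
    {s : ℝ≥0} (h0 : τ 0 < s) (hn : s ≤ τ (Fin.last n)) :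
    ∃ i : Fin n, s ∈ Ioc (τ i.castSucc) (τ i.succ) ∧
      ∀ j ≠ i, s ∉ Ioc (τ j.castSucc) (τ j.succ) := by
  have hex : ∃ i : Fin n, s ∈ Ioc (τ i.castSucc) (τ i.succ) := by
    by_contra! hcon
    -- If no interval contains s, then s lies beyond each successive partition point, including the
    -- last.
    have : ∀ i : Fin (n + 1), τ i < s := by
      intro i
      induction i using Fin.induction with
      | zero => exact h0
      | succ i ih => exact not_le.1 fun h ↦ hcon i ⟨ih, h⟩
    exact absurd hn (not_le.2 (this _))
  obtain ⟨i, hi⟩ := hex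
  refine ⟨i, hi, fun j hji hj ↦ ?_⟩
  rcases lt_or_gt_of_ne hji with h | h
  · exact absurd (hi.1.trans_le (hj.2.trans (hτ (Fin.succ_le_castSucc_iff.2 h)))) (lt_irrefl _)
  · exact absurd (hj.1.trans_le (hi.2.trans (hτ (Fin.succ_le_castSucc_iff.2 h)))) (lt_irrefl _)

variable {E : Type*} [AddCommGroup E]

/-- The left-point step function of `f` along the partition `τ`. -/
noncomputable def leftStep {n : ℕ} (τ : Fin (n + 1) → ℝ≥0) (f : Fin n → E) (s : ℝ≥0) : E :=
  ∑ i : Fin n, (Ioc (τ i.castSucc) (τ i.succ)).indicator (fun _ ↦ f i) s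

lemma exists_leftStep_eq {n : ℕ} {τ : Fin (n + 1) → ℝ≥0} (hτ : Monotone τ)
    {s : ℝ≥0} (h0 : τ 0 < s) (hn : s ≤ τ (Fin.last n)) (f : Fin n → E) :
    ∃ i : Fin n, s ∈ Ioc (τ i.castSucc) (τ i.succ) ∧ leftStep τ f s = f i := by
  obtain ⟨i, hi, hj⟩ := exists_unique_mem_Ioc_partition hτ h0 hn
  refine ⟨i, hi, ?_⟩
  rw [leftStep, Finset.sum_eq_single i (fun j _ hji ↦ indicator_of_notMem (hj j hji) _) (by simp),
    indicator_of_mem hi]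

lemma leftStep_eq_zero {n : ℕ} {τ : Fin (n + 1) → ℝ≥0} (hτ : Monotone τ)
    {s : ℝ≥0} (hn : τ (Fin.last n) < s) (f : Fin n → E) : leftStep τ f s = 0 :=
  Finset.sum_eq_zero fun _ _ ↦ indicator_of_notMem
    (fun h ↦ absurd (h.2.trans (hτ (Fin.le_last _))) (not_le.2 hn)) _

/-- The uniform partition of `[0,t]` into `n` intervals. -/
noncomputable def uniformPartition (t : ℝ≥0) (n : ℕ) (i : Fin (n + 1)) : ℝ≥0 := i * (t / n)

lemma uniformPartition_zero (t : ℝ≥0) (n : ℕ) : uniformPartition t n 0 = 0 := by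
  simp [uniformPartition]

lemma uniformPartition_last (t : ℝ≥0) {n : ℕ} (hn : n ≠ 0) :
    uniformPartition t n (Fin.last n) = t := by
  have : (n : ℝ≥0) ≠ 0 := by exact_mod_cast hn
  simp only [uniformPartition, Fin.val_last]
  field_simp

lemma uniformPartition_monotone (t : ℝ≥0) (n : ℕ) : Monotone (uniformPartition t n) := by
  intro i j hij
  unfold uniformPartition
  gcongr
  exact hij

lemma uniformPartition_strictMono {t : ℝ≥0} (ht : 0 < t) {n : ℕ} (hn : n ≠ 0) :
    StrictMono (uniformPartition t n) := by
  intro i j hij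
  have : 0 < t / n := div_pos ht (by exact_mod_cast Nat.pos_of_ne_zero hn)
  unfold uniformPartition
  gcongr
  exact hij

lemma uniformPartition_le (t : ℝ≥0) {n : ℕ} (hn : n ≠ 0) (i : Fin (n + 1)) :
    uniformPartition t n i ≤ t := by
  conv_rhs => rw [← uniformPartition_last t hn]
  exact uniformPartition_monotone t n (Fin.le_last i)

lemma uniformPartition_succ_sub (t : ℝ≥0) (n : ℕ) (i : Fin n) :
    ((uniformPartition t n i.succ : ℝ≥0) : ℝ) - (uniformPartition t n i.castSucc : ℝ≥0) = t / n := by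
  simp only [uniformPartition, Fin.val_succ, Fin.val_castSucc]
  push_cast
  ring

lemma exists_uniformPartition_mesh_lt (t : ℝ≥0) {δ : ℝ} (hδ : 0 < δ) :
    ∃ n : ℕ, n ≠ 0 ∧ (t : ℝ) / n < δ := by
  obtain ⟨n, hn⟩ := exists_nat_gt ((t : ℝ) / δ)
  have hn0 : (0 : ℝ) < n := lt_of_le_of_lt (by positivity) hn
  refine ⟨n, by exact_mod_cast hn0.ne', ?_⟩
  rw [div_lt_iff₀ hn0]
  rwa [div_lt_iff₀ hδ, mul_comm] at hn

end Partition

/-! ### Riemann sums and elementary integrals as curve integrals. -/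

section Elementary

variable {Ω : Type*} {mΩ : MeasurableSpace Ω} {P : Measure Ω} [IsProbabilityMeasure P]
  {𝓕 : Filtration ℝ≥0 mΩ} {M : ℝ≥0 → Ω → ℝ}
  {H : Type*} [NormedAddCommGroup H] [InnerProductSpace ℝ H] [CompleteSpace H] {T : ℝ≥0}

lemma coeFn_finset_sum {ι : Type*} (S : Finset ι) (f : ι → Lp H 2 P) :
    ((∑ i ∈ S, f i : Lp H 2 P) : Ω → H) =ᵐ[P] fun ω ↦ ∑ i ∈ S, f i ω := by
  classical
  induction S using Finset.induction_on with
  | empty =>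
    simp only [Finset.sum_empty]
    exact Lp.coeFn_zero H 2 P
  | insert a S ha ih =>
    simp_rw [Finset.sum_insert ha]
    filter_upwards [Lp.coeFn_add (f a) (∑ i ∈ S, f i), ih] with ω h1 h2
    rw [h1, Pi.add_apply, h2]

/-- The integral of a left-point step curve is the corresponding Riemann sum. -/
lemma hasCurveIntegral_leftStep (hM : IsSqIntegrableLevyMartingale P 𝓕 M) {n : ℕ}
    {τ : Fin (n + 1) → ℝ≥0} (hτ : Monotone τ) (hT : τ (Fin.last n) ≤ T) {ξ : Fin n → Lp H 2 P}
    (hξ : ∀ i, AEStronglyMeasurable[𝓕 (τ i.castSucc)] (ξ i) P) :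
    ∃ A : Lp H 2 P, HasCurveIntegral P 𝓕 M T (leftStep τ ξ) A ∧
      A =ᵐ[P] fun ω ↦ ∑ i : Fin n, (M (τ i.succ) ω - M (τ i.castSucc) ω) • ξ i ω := by
  have hmem : ∀ i : Fin n, MemLp (fun ω ↦ (M (τ i.succ) ω - M (τ i.castSucc) ω) • ξ i ω) 2 P :=
    fun i ↦ hM.memLp_increment_smul (hτ i.castSucc_le_succ) (hξ i) (Lp.memLp _)
  refine ⟨∑ i, (hmem i).toLp _, HasCurveIntegral.sum _ fun i _ ↦
    HasCurveIntegral.indicator_Ioc (hτ i.castSucc_le_succ) ((hτ (Fin.le_last _)).trans hT) (hξ i)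
      (hmem i).coeFn_toLp, ?_⟩
  filter_upwards [coeFn_finset_sum Finset.univ fun i ↦ (hmem i).toLp _,
    ae_all_iff.2 fun i ↦ (hmem i).coeFn_toLp] with ω h1 h2
  rw [h1]
  exact Finset.sum_congr rfl fun i _ ↦ h2 i

namespace ElementaryProcess

lemma memLp_ξ (X : ElementaryProcess 𝓕 H) (i : Fin X.n) : MemLp (X.ξ i) 2 P := by
  obtain ⟨C, hC⟩ := X.bounded_ξ
  exact MemLp.of_bound ((X.measurable_ξ i).mono (𝓕.le _)).aestronglyMeasurable C
    (Eventually.of_forall fun ω ↦ hC i ω)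

/-- The curve in `L²(P; H)` defined by an elementary process. -/
noncomputable def curve (P : Measure Ω) [IsProbabilityMeasure P] (X : ElementaryProcess 𝓕 H)
    (s : ℝ≥0) : Lp H 2 P :=
  ∑ i, (Ioc (X.u i) (X.v i)).indicator (fun _ ↦ (X.memLp_ξ (P := P) i).toLp (X.ξ i)) s

lemma coeFn_curve (X : ElementaryProcess 𝓕 H) (s : ℝ≥0) :
    X.curve P s =ᵐ[P] X.toFun s := by
  filter_upwards [coeFn_finset_sum (P := P) Finset.univ fun i ↦
    (Ioc (X.u i) (X.v i)).indicator (fun _ ↦ (X.memLp_ξ (P := P) i).toLp (X.ξ i)) s,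
    ae_all_iff.2 fun i ↦ (X.memLp_ξ (P := P) i).coeFn_toLp, Lp.coeFn_zero H 2 P] with ω h1 h2 h3
  rw [curve, h1, toFun]
  refine Finset.sum_congr rfl fun i _ ↦ ?_
  by_cases hs : s ∈ Ioc (X.u i) (X.v i)
  · simp only [indicator_of_mem hs, h2 i]
  · simp only [indicator_of_notMem hs, h3, Pi.zero_apply]

lemma term_eq_zero_or (X : ElementaryProcess 𝓕 H) (i : Fin X.n) (t : ℝ≥0) :
    (t ≤ X.u i ∧ (fun ω ↦ (M (min (X.v i) t) ω - M (min (X.u i) t) ω) • X.ξ i ω) = 0) ∨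
    (X.u i ≤ min (X.v i) t ∧ (fun ω ↦ (M (min (X.v i) t) ω - M (min (X.u i) t) ω) • X.ξ i ω)
      = fun ω ↦ (M (min (X.v i) t) ω - M (X.u i) ω) • X.ξ i ω) := by
  rcases le_total t (X.u i) with h | h
  · left
    refine ⟨h, ?_⟩
    rw [min_eq_right h, min_eq_right (h.trans (X.u_le_v i))]
    simp only [sub_self, zero_smul]
    rfl
  · right
    rw [min_eq_left h]
    exact ⟨le_min (X.u_le_v i) h, rfl⟩

lemma memLp_term (hM : IsSqIntegrableLevyMartingale P 𝓕 M) (X : ElementaryProcess 𝓕 H)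
    (i : Fin X.n) (t : ℝ≥0) :
    MemLp (fun ω ↦ (M (min (X.v i) t) ω - M (min (X.u i) t) ω) • X.ξ i ω) 2 P := by
  rcases X.term_eq_zero_or (M := M) i t with ⟨-, h⟩ | ⟨huv, h⟩
  · rw [h]
    exact MemLp.zero
  · rw [h]
    exact hM.memLp_increment_smul huv (X.measurable_ξ i).aestronglyMeasurable (X.memLp_ξ i)

lemma memLp_integral (hM : IsSqIntegrableLevyMartingale P 𝓕 M) (X : ElementaryProcess 𝓕 H)
    (t : ℝ≥0) : MemLp (X.integral M t) 2 P :=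
  memLp_finsetSum Finset.univ fun i _ ↦ X.memLp_term hM i t

lemma stronglyMeasurable_integral (hM : IsSqIntegrableLevyMartingale P 𝓕 M)
    (X : ElementaryProcess 𝓕 H) (t : ℝ≥0) : StronglyMeasurable[𝓕 t] (X.integral M t) := by
  refine Finset.stronglyMeasurable_fun_sum _ fun i _ ↦ ?_
  rcases X.term_eq_zero_or (M := M) i t with ⟨-, h⟩ | ⟨huv, h⟩
  · rw [h]
    exact stronglyMeasurable_zero
  · rw [h]
    have h1 : StronglyMeasurable[𝓕 t] (M (min (X.v i) t)) :=
      (hM.martingale.stronglyAdapted _).mono (𝓕.mono (min_le_right _ _))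
    have h2 : StronglyMeasurable[𝓕 t] (M (X.u i)) :=
      (hM.martingale.stronglyAdapted _).mono (𝓕.mono (huv.trans (min_le_right _ _)))
    exact (h1.sub h2).smul
      ((X.measurable_ξ i).mono (𝓕.mono (huv.trans (min_le_right _ _))))

/-- The curve integral of an elementary process is its elementary integral. -/
lemma hasCurveIntegral (hM : IsSqIntegrableLevyMartingale P 𝓕 M) (X : ElementaryProcess 𝓕 H)
    {t : ℝ≥0} (ht : t ≤ T) :
    HasCurveIntegral P 𝓕 M T ((Iic t).indicator (X.curve P))
      ((X.memLp_integral hM t).toLp (X.integral M t)) := by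
  have hcurve : (Iic t).indicator (X.curve P) = fun s ↦ ∑ i,
      (Ioc (X.u i) (min (X.v i) t)).indicator
        (fun _ ↦ (X.memLp_ξ (P := P) i).toLp (X.ξ i)) s := by
    ext1 s
    by_cases hs : s ≤ t
    · rw [indicator_of_mem (mem_Iic.2 hs), curve]
      refine Finset.sum_congr rfl fun i _ ↦ ?_
      simp only [indicator, mem_Ioc, le_min_iff, hs, and_true]
    · rw [indicator_of_notMem (by simpa using hs)]
      refine (Finset.sum_eq_zero fun i _ ↦ indicator_of_notMem ?_ _).symm
      simp [hs]
  have hint : (X.memLp_integral hM t).toLp (X.integral M t)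
      = ∑ i, (X.memLp_term hM i t).toLp _ := by
    refine Lp.ext ?_
    filter_upwards [(X.memLp_integral hM t).coeFn_toLp,
      coeFn_finset_sum Finset.univ fun i ↦ (X.memLp_term hM i t).toLp _,
      ae_all_iff.2 fun i ↦ (X.memLp_term hM i t).coeFn_toLp] with ω h1 h2 h3
    rw [h1, h2]
    exact Finset.sum_congr rfl fun i _ ↦ (h3 i).symm
  rw [hcurve, hint]
  refine HasCurveIntegral.sum _ fun i _ ↦ ?_
  rcases X.term_eq_zero_or (M := M) i t with ⟨htu, h⟩ | ⟨huv, h⟩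
  · have h1 : (X.memLp_term hM i t).toLp _ = 0 := by
      rw [← MemLp.toLp_zero (MemLp.zero : MemLp (0 : Ω → H) 2 P)]
      exact (MemLp.toLp_eq_toLp_iff _ _).2 (by rw [h])
    rw [h1, Ioc_eq_empty (by simp [htu]), indicator_empty]
    exact HasCurveIntegral.zero
  · refine HasCurveIntegral.indicator_Ioc huv ((min_le_right _ _).trans ht)
      ((X.measurable_ξ i).aestronglyMeasurable.congr (X.memLp_ξ (P := P) i).coeFn_toLp.symm) ?_
    filter_upwards [(X.memLp_term hM i t).coeFn_toLp, (X.memLp_ξ (P := P) i).coeFn_toLp]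
      with ω h1 h2
    rw [h1, h2]
    exact congrFun h ω

end ElementaryProcess

end Elementary

/-! ### Approximation of adapted curves and existence of their integral. -/

section Approximation

variable {Ω : Type*} {mΩ : MeasurableSpace Ω} {P : Measure Ω} [IsProbabilityMeasure P]
  {𝓕 : Filtration ℝ≥0 mΩ} {M : ℝ≥0 → Ω → ℝ}
  {H : Type*} [NormedAddCommGroup H] [InnerProductSpace ℝ H] [CompleteSpace H] {T : ℝ≥0}

/-- Bounded `m`-measurable functions are dense in the `m`-measurable elements of `L²`. -/
lemma exists_bounded_stronglyMeasurable_near {m : MeasurableSpace Ω} (hm : m ≤ mΩ)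
    {η : Lp H 2 P} (hη : AEStronglyMeasurable[m] η P) {ε : ℝ} (hε : 0 < ε) :
    ∃ ξ : Ω → H, StronglyMeasurable[m] ξ ∧ (∃ C : ℝ, ∀ ω, ‖ξ ω‖ ≤ C) ∧
      ∀ h : MemLp ξ 2 P, ‖h.toLp ξ - η‖ ≤ ε := by
  obtain ⟨g, hg, hηg⟩ := hη
  have hgL : MemLp g 2 P := (Lp.memLp η).ae_eq hηg
  -- Over the trimmed measure the approximating simple functions are automatically `m`-measurable.
  have hgT : MemLp g 2 (P.trim hm) := 
    ⟨hg.aestronglyMeasurable, by rw [eLpNorm_trim hm hg]; exact hgL.2⟩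
  obtain ⟨f, hf, hf2⟩ := hgT.exists_simpleFunc_eLpNorm_sub_lt (by norm_num)
    (ε := ENNReal.ofReal ε) (by simpa using hε)
  refine ⟨f, f.stronglyMeasurable, f.exists_forall_norm_le, fun h ↦ ?_⟩
  have h1 : ‖h.toLp f - η‖ₑ ≤ ENNReal.ofReal ε := by
    have heq : h.toLp f - η = (h.sub hgL).toLp (⇑f - g) := by
      rw [MemLp.toLp_sub h hgL]
      congr 1
      refine Lp.ext ?_
      filter_upwards [hηg, hgL.coeFn_toLp] with ω h1 h2
      rw [h1, h2]
    rw [heq, Lp.enorm_toLp, eLpNorm_sub_comm]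
    rw [eLpNorm_trim hm (hg.sub f.stronglyMeasurable)] at hf
    exact hf.le
  rw [← ofReal_norm] at h1
  exact (ENNReal.ofReal_le_ofReal_iff hε.le).1 h1

/-- Extension of a curve on `[0,T]` to all times, constant after `T`. -/
noncomputable def extendCurve (Φ : C(Icc (0 : ℝ≥0) T, Lp H 2 P)) : ℝ≥0 → Lp H 2 P :=
  IccExtend zero_le Φ

lemma extendCurve_of_mem (Φ : C(Icc (0 : ℝ≥0) T, Lp H 2 P)) (s : Icc (0 : ℝ≥0) T) :
    extendCurve Φ s = Φ s :=
  IccExtend_val _ _ s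

lemma continuous_extendCurve (Φ : C(Icc (0 : ℝ≥0) T, Lp H 2 P)) : Continuous (extendCurve Φ) :=
  Φ.continuous.Icc_extend'

lemma norm_extendCurve_le (Φ : C(Icc (0 : ℝ≥0) T, Lp H 2 P)) (s : ℝ≥0) :
    ‖extendCurve Φ s‖ ≤ ‖Φ‖ :=
  Φ.norm_coe_le_norm _

lemma memLp_extendCurve (Φ : C(Icc (0 : ℝ≥0) T, Lp H 2 P)) :
    MemLp (extendCurve Φ) 2 (lebesgue T) :=
  MemLp.of_bound (continuous_extendCurve Φ).stronglyMeasurable.aestronglyMeasurable ‖Φ‖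
    (Eventually.of_forall (norm_extendCurve_le Φ))

lemma exists_modulus (Φ : C(Icc (0 : ℝ≥0) T, Lp H 2 P)) {ε : ℝ} (hε : 0 < ε) :
    ∃ δ : ℝ, 0 < δ ∧ ∀ s t : ℝ≥0, s ≤ t → t ≤ T → (t : ℝ) - s < δ →
      ‖extendCurve Φ s - extendCurve Φ t‖ < ε := by
  obtain ⟨δ, hδ, h⟩ := Metric.uniformContinuous_iff.1
    (CompactSpace.uniformContinuous_of_continuous Φ.continuous) ε hε
  refine ⟨δ, hδ, fun s t hst htT hd ↦ ?_⟩
  have := @h ⟨s, zero_le, hst.trans htT⟩ ⟨t, zero_le, htT⟩ (by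
    rw [Subtype.dist_eq, NNReal.dist_eq, abs_sub_comm, abs_of_nonneg]
    · exact hd
    · exact sub_nonneg.2 (by exact_mod_cast hst))
  rw [← extendCurve_of_mem, ← extendCurve_of_mem, dist_eq_norm] at this
  exact this

/-- Up to t, the left endpoint of the interval containing s is within the mesh of s; beyond t both
curves vanish. -/
lemma norm_leftStep_sub_extendCurve_lt (Φ : C(Icc (0 : ℝ≥0) T, Lp H 2 P)) {ε δ : ℝ}
    (hδ : ∀ s t : ℝ≥0, s ≤ t → t ≤ T → (t : ℝ) - s < δ →
      ‖extendCurve Φ s - extendCurve Φ t‖ < ε) (hε : 0 < ε) {n : ℕ} {τ : Fin (n + 1) → ℝ≥0}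
    (hτ : Monotone τ) (h0 : τ 0 = 0) {t : ℝ≥0} (ht : τ (Fin.last n) = t) (htT : t ≤ T)
    (hmesh : ∀ i : Fin n, ((τ i.succ : ℝ≥0) : ℝ) - (τ i.castSucc : ℝ≥0) < δ) {s : ℝ≥0}
    (hs : 0 < s) :
    ‖leftStep τ (fun i ↦ extendCurve Φ (τ i.castSucc)) s
      - (Iic t).indicator (extendCurve Φ) s‖ < ε := by
  by_cases hst : s ≤ t
  · obtain ⟨i, hi, heq⟩ := exists_leftStep_eq hτ (h0 ▸ hs) (hst.trans ht.ge)
      (fun i ↦ extendCurve Φ (τ i.castSucc))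
    rw [heq, indicator_of_mem (mem_Iic.2 hst)]
    refine hδ _ _ hi.1.le (hst.trans htT) (lt_of_le_of_lt ?_ (hmesh i))
    have : (s : ℝ) ≤ τ i.succ := by exact_mod_cast hi.2
    linarith
  · rw [leftStep_eq_zero hτ (ht ▸ not_le.1 hst), indicator_of_notMem (by simpa using hst)]
    simpa using hε

/-- Uniform approximation of an adapted curve by elementary processes. -/
lemma exists_elementary_near {Φ : C(Icc (0 : ℝ≥0) T, Lp H 2 P)} (hΦ : Φ ∈ Cad P 𝓕 H T)
    {ε : ℝ} (hε : 0 < ε) :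
    ∃ X : ElementaryProcess 𝓕 H, ∀ s ∈ Ioc 0 T, ‖X.curve P s - extendCurve Φ s‖ ≤ ε := by
  -- Half of ε pays for freezing Φ at the left endpoint, the other half for replacing that value by
  -- a bounded one.
  obtain ⟨δ, hδ, hmod⟩ := exists_modulus Φ (half_pos hε)
  obtain ⟨n, hn, hmesh⟩ := exists_uniformPartition_mesh_lt T hδ
  have hmeas : ∀ i : Fin n, AEStronglyMeasurable[𝓕 (uniformPartition T n i.castSucc)]
      (extendCurve Φ (uniformPartition T n i.castSucc)) P := fun i ↦ by
    have := hΦ ⟨uniformPartition T n i.castSucc, zero_le, uniformPartition_le T hn _⟩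
    rwa [← extendCurve_of_mem] at this
  choose ξ hξm hξb hξ using fun i ↦
    exists_bounded_stronglyMeasurable_near (𝓕.le _) (hmeas i) (half_pos hε)
  choose C hC using hξb
  let X : ElementaryProcess 𝓕 H :=
    { n := n
      u := fun i ↦ uniformPartition T n i.castSucc
      v := fun i ↦ uniformPartition T n i.succ
      u_le_v := fun i ↦ uniformPartition_monotone T n i.castSucc_le_succ
      ξ := ξ
      measurable_ξ := hξm
      bounded_ξ := ⟨∑ i, |C i|, fun i ω ↦ (hC i ω).trans ((le_abs_self _).trans
        (Finset.single_le_sum (f := fun i ↦ |C i|) (fun _ _ ↦ abs_nonneg _)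
          (Finset.mem_univ i)))⟩ }
  refine ⟨X, fun s hs ↦ ?_⟩
  obtain ⟨i, hi, heq⟩ := exists_leftStep_eq (uniformPartition_monotone T n)
    ((uniformPartition_zero T n).symm ▸ hs.1) ((uniformPartition_last T hn).symm ▸ hs.2)
    (fun i ↦ (X.memLp_ξ (P := P) i).toLp (X.ξ i))
  have hcurve : X.curve P s = (X.memLp_ξ (P := P) i).toLp (X.ξ i) := heq
  rw [hcurve]
  have h1 := hξ i (X.memLp_ξ (P := P) i)
  have h2 := hmod (uniformPartition T n i.castSucc) s hi.1.le hs.2 (by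
    have h3 := uniformPartition_succ_sub T n i
    have h4 : (s : ℝ) ≤ uniformPartition T n i.succ := by exact_mod_cast hi.2
    linarith)
  calc _ ≤ ‖(X.memLp_ξ (P := P) i).toLp (X.ξ i) - extendCurve Φ (uniformPartition T n i.castSucc)‖
        + ‖extendCurve Φ (uniformPartition T n i.castSucc) - extendCurve Φ s‖ :=
        norm_sub_le_norm_sub_add_norm_sub _ _ _
    _ ≤ ε := by linarith

/-- The Lipschitz constant of the integral with respect to the supremum norm of curves. -/
noncomputable def curveIntegralConst (P : Measure Ω) (M : ℝ≥0 → Ω → ℝ) (T : ℝ≥0) : ℝ :=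
  √(varianceRate P M) * (lebesgue T).real univ ^ (2 : ℝ)⁻¹

lemma curveIntegralConst_nonneg : 0 ≤ curveIntegralConst P M T := by
  unfold curveIntegralConst
  positivity

lemma eLpNorm_lebesgue_le {E : Type*} [NormedAddCommGroup E] {g : ℝ≥0 → E} {ε : ℝ}
    (h : ∀ s ∈ Ioc 0 T, ‖g s‖ ≤ ε) :
    eLpNorm g 2 (lebesgue T) ≤ lebesgue T univ ^ (2 : ℝ)⁻¹ * ENNReal.ofReal ε := by
  have := eLpNorm_le_of_ae_bound (p := 2) (μ := lebesgue T) (f := g) (C := ε) (by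
    filter_upwards [ae_lebesgue_mem_Ioc T] with s hs using h s hs)
  simpa using this

lemma tendsto_eLpNorm_lebesgue {E : Type*} [NormedAddCommGroup E] {g : ℕ → ℝ≥0 → E} {ε : ℕ → ℝ}
    (h : ∀ k, ∀ s ∈ Ioc 0 T, ‖g k s‖ ≤ ε k) (hε : Tendsto ε atTop (𝓝 0)) :
    Tendsto (fun k ↦ eLpNorm (g k) 2 (lebesgue T)) atTop (𝓝 0) := by
  have h1 : Tendsto (fun k ↦ lebesgue T univ ^ (2 : ℝ)⁻¹ * ENNReal.ofReal (ε k)) atTop (𝓝 0) := by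
    have := ENNReal.Tendsto.const_mul (a := lebesgue T univ ^ (2 : ℝ)⁻¹)
      (ENNReal.tendsto_ofReal hε) (Or.inr (ENNReal.rpow_ne_top_of_nonneg (by norm_num)
        (measure_ne_top _ _)))
    simpa using this
  exact tendsto_of_tendsto_of_tendsto_of_le_of_le tendsto_const_nhds h1 (fun _ ↦ zero_le)
    fun k ↦ eLpNorm_lebesgue_le (h k)

/-- The isometry combined with finiteness of λ on [0,T] bounds integrals by the supremum norm. -/
lemma HasCurveIntegral.norm_sub_le (hM : IsSqIntegrableLevyMartingale P 𝓕 M)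
    {g h : ℝ≥0 → Lp H 2 P} {A B : Lp H 2 P} (hg : HasCurveIntegral P 𝓕 M T g A)
    (hh : HasCurveIntegral P 𝓕 M T h B) {ε : ℝ} (hε : 0 ≤ ε)
    (hgh : ∀ s ∈ Ioc 0 T, ‖g s - h s‖ ≤ ε) : ‖A - B‖ ≤ curveIntegralConst P M T * ε := by
  have h1 := hg.enorm_sub hM hh
  have h2 : ‖A - B‖ₑ ≤ ENNReal.ofReal (curveIntegralConst P M T * ε) := by
    rw [h1, curveIntegralConst, mul_assoc, ENNReal.ofReal_mul (Real.sqrt_nonneg _),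
      ENNReal.ofReal_mul (by positivity), ← ENNReal.ofReal_rpow_of_nonneg (by positivity)
      (by norm_num), ofReal_measureReal]
    gcongr
    exact eLpNorm_lebesgue_le hgh
  rw [← ofReal_norm] at h2
  exact (ENNReal.ofReal_le_ofReal_iff (mul_nonneg curveIntegralConst_nonneg hε)).1 h2

/-- The integral of an adapted curve over `[0,t]` exists and is `𝓕 t`-measurable. -/
lemma exists_hasCurveIntegral (hM : IsSqIntegrableLevyMartingale P 𝓕 M)
    {Φ : C(Icc (0 : ℝ≥0) T, Lp H 2 P)} (hΦ : Φ ∈ Cad P 𝓕 H T) {t : ℝ≥0} (ht : t ≤ T) :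
    ∃ A : Lp H 2 P, HasCurveIntegral P 𝓕 M T ((Iic t).indicator (extendCurve Φ)) A ∧
      AEStronglyMeasurable[𝓕 t] A P := by
  have hpos : ∀ k : ℕ, (0 : ℝ) < 1 / (k + 1 : ℝ) := fun k ↦ Nat.one_div_pos_of_nat
  choose X hX using fun k : ℕ ↦ exists_elementary_near hΦ (hpos k)
  have hle : ∀ k, ∀ s ∈ Ioc 0 T, ‖(Iic t).indicator ((X k).curve P) s
      - (Iic t).indicator (extendCurve Φ) s‖ ≤ 1 / (k + 1 : ℝ) := by
    intro k s hs
    by_cases hst : s ∈ Iic t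
    · rw [indicator_of_mem hst, indicator_of_mem hst]
      exact hX k s hs
    · rw [indicator_of_notMem hst, indicator_of_notMem hst, sub_self, norm_zero]
      exact (hpos k).le
  have hint := fun k ↦ (X k).hasCurveIntegral hM ht
  obtain ⟨A, hA⟩ := HasCurveIntegral.exists_of_tendsto hM hint
    ((memLp_extendCurve Φ).indicator measurableSet_Iic)
    (tendsto_eLpNorm_lebesgue hle tendsto_one_div_add_atTop_nhds_zero_nat)
  refine ⟨A, hA, ?_⟩
  have hlim : Tendsto (fun k ↦ ((X k).memLp_integral hM t).toLp ((X k).integral M t)) atTop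
      (𝓝 A) := by
    rw [tendsto_iff_norm_sub_tendsto_zero]
    have h1 := (tendsto_one_div_add_atTop_nhds_zero_nat (𝕜 := ℝ)).const_mul
      (curveIntegralConst P M T)
    rw [mul_zero] at h1
    exact squeeze_zero (fun _ ↦ norm_nonneg _)
      (fun k ↦ (hint k).norm_sub_le hM hA (hpos k).le (hle k)) h1
  -- Adaptedness passes to L² limits because the 𝓕 t-measurable classes form a closed set.
  exact (isClosed_aestronglyMeasurable (𝓕.le t)).mem_of_tendsto hlim
    (Eventually.of_forall fun k ↦ ((X k).stronglyMeasurable_integral hM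
      t).aestronglyMeasurable.congr ((X k).memLp_integral hM t).coeFn_toLp.symm)

/-- The integrands differ only on (s,t], where they are bounded by ‖Φ‖. The resulting Hölder-1/2
bound makes the integral a continuous curve. -/
lemma HasCurveIntegral.norm_sub_le_sqrt (hM : IsSqIntegrableLevyMartingale P 𝓕 M)
    {Φ : C(Icc (0 : ℝ≥0) T, Lp H 2 P)} {s t : ℝ≥0} (hst : s ≤ t) (htT : t ≤ T) {A B : Lp H 2 P}
    (hA : HasCurveIntegral P 𝓕 M T ((Iic s).indicator (extendCurve Φ)) A)
    (hB : HasCurveIntegral P 𝓕 M T ((Iic t).indicator (extendCurve Φ)) B) :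
    ‖B - A‖ ≤ √(varianceRate P M) * (‖Φ‖ * √(t - s)) := by
  have h1 := hB.enorm_sub hM hA
  have h2 : eLpNorm ((Iic t).indicator (extendCurve Φ) - (Iic s).indicator (extendCurve Φ)) 2
      (lebesgue T) ≤ ENNReal.ofReal (‖Φ‖ * √(t - s)) := by
    have h3 := eLpNorm_mono (p := 2) (μ := lebesgue T)
      (f := (Iic t).indicator (extendCurve Φ) - (Iic s).indicator (extendCurve Φ))
      (g := (Ioc s t).indicator fun _ ↦ ‖Φ‖) (fun r ↦ by
        by_cases hr : r ∈ Ioc s t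
        · have h4 : r ∉ Iic s := by simpa using hr.1
          have h5 : r ∈ Iic t := hr.2
          rw [Pi.sub_apply, indicator_of_mem hr, indicator_of_mem h5, indicator_of_notMem h4,
            sub_zero, norm_norm]
          exact norm_extendCurve_le Φ r
        · rw [Pi.sub_apply, indicator_of_notMem hr]
          by_cases hrs : r ≤ s
          · rw [indicator_of_mem (mem_Iic.2 hrs), indicator_of_mem (mem_Iic.2 (hrs.trans hst)),
              sub_self, norm_zero, norm_zero]
          · have h4 : r ∉ Iic s := by simpa using hrs
            have h5 : r ∉ Iic t := fun h ↦ hr ⟨not_le.1 hrs, h⟩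
            rw [indicator_of_notMem h4, indicator_of_notMem h5, sub_self, norm_zero, norm_zero])
    refine h3.trans ?_
    rw [eLpNorm_indicator_const measurableSet_Ioc (by norm_num) (by norm_num), lebesgue_Ioc htT,
      enorm_norm, ENNReal.ofReal_mul (norm_nonneg _), ofReal_norm, Real.sqrt_eq_rpow,
      ← NNReal.coe_sub hst, ← ENNReal.ofReal_rpow_of_nonneg (by positivity) (by norm_num),
      ENNReal.ofReal_coe_nnreal]
    simp
  have h4 : ‖B - A‖ₑ ≤ ENNReal.ofReal (√(varianceRate P M) * (‖Φ‖ * √(t - s))) := by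
    rw [h1, ENNReal.ofReal_mul (Real.sqrt_nonneg _)]
    gcongr
  rw [← ofReal_norm] at h4
  exact (ENNReal.ofReal_le_ofReal_iff (by positivity)).1 h4

/-- The integral of an adapted curve is an adapted curve. -/
lemma exists_integral_curve (hM : IsSqIntegrableLevyMartingale P 𝓕 M)
    {Φ : C(Icc (0 : ℝ≥0) T, Lp H 2 P)} (hΦ : Φ ∈ Cad P 𝓕 H T) :
    ∃ Y ∈ Cad P 𝓕 H T, ∀ t : Icc (0 : ℝ≥0) T,
      HasCurveIntegral P 𝓕 M T ((Iic (t : ℝ≥0)).indicator (extendCurve Φ)) (Y t) := by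
  choose Y hY hYm using fun t : Icc (0 : ℝ≥0) T ↦ exists_hasCurveIntegral hM hΦ t.2.2
  have hdist : ∀ s t, dist (Y s) (Y t) ≤ √(varianceRate P M) * (‖Φ‖ * √(dist s t)) := by
    have hle : ∀ s t, s ≤ t → dist (Y s) (Y t) ≤ √(varianceRate P M) * (‖Φ‖ * √(dist s t)) := by
      intro s t hst
      have hst' : (s : ℝ≥0) ≤ t := hst
      rw [dist_comm, dist_eq_norm, Subtype.dist_eq, NNReal.dist_eq, abs_sub_comm, abs_of_nonneg
        (sub_nonneg.2 (by exact_mod_cast hst'))]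
      exact HasCurveIntegral.norm_sub_le_sqrt hM hst' t.2.2 (hY s) (hY t)
    intro s t
    rcases le_total s t with h | h
    · exact hle s t h
    · rw [dist_comm, dist_comm s t]
      exact hle t s h
  have hcont : Continuous Y := by
    rw [continuous_iff_continuousAt]
    intro t
    rw [ContinuousAt, tendsto_iff_dist_tendsto_zero]
    refine squeeze_zero (fun _ ↦ dist_nonneg) (fun s ↦ hdist s t) ?_
    have : Continuous fun s ↦ √(varianceRate P M) * (‖Φ‖ * √(dist s t)) := by fun_prop
    simpa using this.tendsto t
  exact ⟨⟨Y, hcont⟩, hYm, hY⟩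

end Approximation

/-! ### Predictability of elementary processes. -/

section Predictable

variable {Ω : Type*} {mΩ : MeasurableSpace Ω} {𝓕 : Filtration ℝ≥0 mΩ}
  {H : Type*} [NormedAddCommGroup H]

lemma predictable_le_prod (𝓕 : Filtration ℝ≥0 mΩ) :
    𝓕.predictable ≤ Prod.instMeasurableSpace :=
  measurableSpace_le_predictable_of_measurableSet
    (fun _ hA ↦ (measurableSet_singleton _).prod (𝓕.le _ _ hA))
    (fun _ _ hA ↦ measurableSet_Ioi.prod (𝓕.le _ _ hA))

lemma stronglyMeasurable_indicator_Ioc_predictable [TopologicalSpace.SeparableSpace H]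
    (u v : ℝ≥0) {ξ : Ω → H} (hξ : StronglyMeasurable[𝓕 u] ξ) :
    StronglyMeasurable[𝓕.predictable]
      (fun p : ℝ≥0 × Ω ↦ (Ioc u v).indicator (fun _ ↦ ξ p.2) p.1) := by
  have := UniformSpace.secondCountable_of_separable H
  borelize H
  refine Measurable.stronglyMeasurable fun B hB ↦ ?_
  have heq : (fun p : ℝ≥0 × Ω ↦ (Ioc u v).indicator (fun _ ↦ ξ p.2) p.1) ⁻¹' B
      = (Ioc u v ×ˢ (ξ ⁻¹' B)) ∪ ((Ioc u v ×ˢ univ)ᶜ ∩ {_p | (0 : H) ∈ B}) := by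
    ext p
    by_cases hp : p.1 ∈ Ioc u v
    · simp [hp]
    · simp [hp]
  rw [heq]
  exact (measurableSet_predictable_Ioc_prod u v (hξ.measurable hB)).union
    ((measurableSet_predictable_Ioc_prod u v MeasurableSet.univ).compl.inter
      (MeasurableSet.const _))

lemma ElementaryProcess.isStronglyPredictable [TopologicalSpace.SeparableSpace H]
    (X : ElementaryProcess 𝓕 H) : IsStronglyPredictable 𝓕 X.toFun := by
  have := Finset.stronglyMeasurable_fun_sum Finset.univ fun i _ ↦
    stronglyMeasurable_indicator_Ioc_predictable (X.u i) (X.v i) (X.measurable_ξ i)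
  exact this

end Predictable

/-! ### Identification of both integrals with the curve integral; the predictable version. -/

section Integrals

variable {Ω : Type*} {mΩ : MeasurableSpace Ω} {P : Measure Ω} [IsProbabilityMeasure P]
  {𝓕 : Filtration ℝ≥0 mΩ} {M : ℝ≥0 → Ω → ℝ}
  {H : Type*} [NormedAddCommGroup H] [InnerProductSpace ℝ H] [CompleteSpace H] {T : ℝ≥0}

lemma lintegral_enorm_sq_eq {α E : Type*} {mα : MeasurableSpace α} [NormedAddCommGroup E]
    (μ : Measure α) (f : α → E) : ∫⁻ a, ‖f a‖ₑ ^ 2 ∂μ = eLpNorm f 2 μ ^ 2 := by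
  have := eLpNorm_nnreal_pow_eq_lintegral (μ := μ) (f := f) (p := 2) (by norm_num)
  simpa using this.symm

lemma lintegral_enorm_sub_sq_eq {A B : Lp H 2 P} {F G : Ω → H} (hF : F =ᵐ[P] A)
    (hG : G =ᵐ[P] B) : ∫⁻ ω, ‖F ω - G ω‖ₑ ^ 2 ∂P = ‖A - B‖ₑ ^ 2 := by
  rw [lintegral_enorm_sq_eq, Lp.enorm_def]
  congr 1
  refine eLpNorm_congr_ae ?_
  filter_upwards [hF, hG, Lp.coeFn_sub A B] with ω h1 h2 h3
  rw [h3, h1, h2, Pi.sub_apply]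

lemma enorm_sq_lt_ofReal_iff {A : Lp H 2 P} {ε : ℝ} (hε : 0 < ε) :
    ‖A‖ₑ ^ 2 < ENNReal.ofReal ε ↔ ‖A‖ < √ε := by
  rw [← ofReal_norm, ← ENNReal.ofReal_pow (norm_nonneg _), ENNReal.ofReal_lt_ofReal_iff hε,
    Real.lt_sqrt (norm_nonneg _)]

lemma tendsto_zero_of_tendsto_sq_zero {a : ℕ → ℝ≥0∞}
    (h : Tendsto (fun k ↦ a k ^ 2) atTop (𝓝 0)) : Tendsto a atTop (𝓝 0) := by
  have := (ENNReal.continuous_rpow_const (y := (2 : ℝ)⁻¹)).tendsto 0 |>.comp h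
  rw [ENNReal.zero_rpow_of_pos (by norm_num)] at this
  refine this.congr fun k ↦ ?_
  rw [Function.comp_apply, ← ENNReal.rpow_natCast, ← ENNReal.rpow_mul]
  norm_num

/-- Tonelli's theorem for the `L²` norm of a process that is a version of a curve. -/
lemma lintegral_prod_eq_eLpNorm_curve {F : ℝ≥0 → Ω → H}
    (hF : StronglyMeasurable (Function.uncurry F)) {f : ℝ≥0 → Lp H 2 P}
    (hFf : ∀ s ∈ Ioc 0 T, F s =ᵐ[P] f s) :
    ∫⁻ p, ‖F p.1 p.2‖ₑ ^ 2 ∂((lebesgue T).prod P) = eLpNorm f 2 (lebesgue T) ^ 2 := by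
  have hmeas : Measurable fun p : ℝ≥0 × Ω ↦ ‖F p.1 p.2‖ₑ ^ 2 := hF.enorm.pow_const 2
  rw [lintegral_prod _ hmeas.aemeasurable, ← lintegral_enorm_sq_eq]
  refine lintegral_congr_ae ?_
  filter_upwards [ae_lebesgue_mem_Ioc T] with s hs
  rw [lintegral_enorm_sq_eq, Lp.enorm_def, eLpNorm_congr_ae (hFf s hs)]

/-- Riemann sums as integrals of left-point step curves. -/
lemma hasCurveIntegral_riemannSum (hM : IsSqIntegrableLevyMartingale P 𝓕 M)
    {Φ : C(Icc (0 : ℝ≥0) T, Lp H 2 P)} (hΦ : Φ ∈ Cad P 𝓕 H T) {n : ℕ}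
    {τ : Fin (n + 1) → Icc (0 : ℝ≥0) T} (hτ : Monotone τ) :
    ∃ A : Lp H 2 P, HasCurveIntegral P 𝓕 M T (leftStep (fun i ↦ (τ i : ℝ≥0))
        (fun i ↦ extendCurve Φ (τ i.castSucc))) A ∧
      (fun ω ↦ ∑ i : Fin n, (M (τ i.succ) ω - M (τ i.castSucc) ω) • Φ (τ i.castSucc) ω)
        =ᵐ[P] A := by
  obtain ⟨A, hA, hA'⟩ := hasCurveIntegral_leftStep hM (τ := fun i ↦ (τ i : ℝ≥0))
    (fun i j hij ↦ hτ hij) (τ (Fin.last n)).2.2 (ξ := fun i ↦ extendCurve Φ (τ i.castSucc))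
    (fun i ↦ by rw [extendCurve_of_mem]; exact hΦ _)
  simp only [extendCurve_of_mem] at hA'
  exact ⟨A, hA, hA'.symm⟩

lemma isGIntegral_of_hasCurveIntegral (hM : IsSqIntegrableLevyMartingale P 𝓕 M)
    {Φ : C(Icc (0 : ℝ≥0) T, Lp H 2 P)} (hΦ : Φ ∈ Cad P 𝓕 H T) {Y : Icc (0 : ℝ≥0) T → Lp H 2 P}
    (hY : ∀ t : Icc (0 : ℝ≥0) T,
      HasCurveIntegral P 𝓕 M T ((Iic (t : ℝ≥0)).indicator (extendCurve Φ)) (Y t)) :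
    IsGIntegral M Φ Y := by
  intro t ε hε
  have hK := curveIntegralConst_nonneg (P := P) (M := M) (T := T)
  set K := curveIntegralConst P M T
  -- The +1 permits K = 0 and makes K * (√ε / (K + 1)) strictly smaller than √ε.
  have hη : 0 < √ε / (K + 1) := by positivity
  obtain ⟨δ, hδ, hmod⟩ := exists_modulus Φ hη
  refine ⟨δ, hδ, fun n τ hτ h0 ht hmesh ↦ ?_⟩
  obtain ⟨A, hA, hAS⟩ := hasCurveIntegral_riemannSum hM hΦ hτ.monotone
  rw [lintegral_enorm_sub_sq_eq EventuallyEq.rfl hAS, enorm_sq_lt_ofReal_iff hε, norm_sub_rev]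
  have h1 : ‖A - Y t‖ ≤ K * (√ε / (K + 1)) :=
    hA.norm_sub_le hM (hY t) hη.le fun s hs ↦
      (norm_leftStep_sub_extendCurve_lt Φ hmod hη (fun i j hij ↦ hτ.monotone hij) h0
        (congrArg Subtype.val ht) t.2.2 hmesh hs.1).le
  refine h1.trans_lt ?_
  have h2 : 0 < √ε := Real.sqrt_pos.2 hε
  rw [← mul_div_assoc, div_lt_iff₀ (by positivity)]
  nlinarith

lemma exists_strictMono_partition (t : Icc (0 : ℝ≥0) T) {δ : ℝ} (hδ : 0 < δ) :
    ∃ (n : ℕ) (τ : Fin (n + 1) → Icc (0 : ℝ≥0) T), StrictMono τ ∧ (τ 0 : ℝ≥0) = 0 ∧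
      τ (Fin.last n) = t ∧
      ∀ i : Fin n, ((τ i.succ : ℝ≥0) : ℝ) - ((τ i.castSucc : ℝ≥0) : ℝ) < δ := by
  rcases eq_or_lt_of_le t.2.1 with h | h
  -- For t = 0 the only partition is the single point, with an empty Riemann sum.
  · exact ⟨0, fun _ ↦ t, (Subsingleton.strictMono (α := Fin 1) _), h.symm, rfl, fun i ↦ i.elim0⟩
  · obtain ⟨n, hn, hmesh⟩ := exists_uniformPartition_mesh_lt t hδ
    refine ⟨n, fun i ↦ ⟨uniformPartition t n i, zero_le,
      (uniformPartition_le _ hn i).trans t.2.2⟩,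
      fun i j hij ↦ uniformPartition_strictMono h hn hij, uniformPartition_zero _ n,
      Subtype.ext (uniformPartition_last _ hn), fun i ↦ ?_⟩
    exact (uniformPartition_succ_sub _ n i).trans_lt hmesh

/-- Partitions of arbitrarily small mesh exist, so one Riemann sum can be close to both candidates.
-/
lemma IsGIntegral.unique (hM : IsSqIntegrableLevyMartingale P 𝓕 M)
    {Φ : C(Icc (0 : ℝ≥0) T, Lp H 2 P)} (hΦ : Φ ∈ Cad P 𝓕 H T)
    {Y Z : Icc (0 : ℝ≥0) T → Lp H 2 P} (hY : IsGIntegral M Φ Y) (hZ : IsGIntegral M Φ Z) :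
    Y = Z := by
  ext1 t
  rw [← sub_eq_zero, ← norm_le_zero_iff]
  refine le_of_forall_pos_le_add fun ε hε ↦ ?_
  have hε2 : 0 < (ε / 2) ^ 2 := by positivity
  obtain ⟨δ, hδ, h1⟩ := hY t _ hε2
  obtain ⟨δ', hδ', h2⟩ := hZ t _ hε2
  obtain ⟨n, τ, hτ, h0, ht, hmesh⟩ := exists_strictMono_partition t (lt_min hδ hδ')
  obtain ⟨A, -, hAS⟩ := hasCurveIntegral_riemannSum hM hΦ hτ.monotone
  have h3 := h1 n τ hτ h0 ht fun i ↦ (hmesh i).trans_le (min_le_left _ _)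
  have h4 := h2 n τ hτ h0 ht fun i ↦ (hmesh i).trans_le (min_le_right _ _)
  rw [lintegral_enorm_sub_sq_eq EventuallyEq.rfl hAS, enorm_sq_lt_ofReal_iff hε2,
    Real.sqrt_sq (by positivity)] at h3 h4
  have h5 := norm_sub_le_norm_sub_add_norm_sub (Y t) A (Z t)
  rw [norm_sub_rev A] at h5
  linarith

variable {Φ : C(Icc (0 : ℝ≥0) T, Lp H 2 P)}

lemma IsVersion.ae_eq_extendCurve {Ψ : ℝ≥0 → Ω → H} (hΨ : IsVersion Ψ Φ) {s : ℝ≥0}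
    (hs : s ≤ T) : Ψ s =ᵐ[P] extendCurve Φ s := by
  have := hΨ ⟨s, zero_le, hs⟩
  rwa [← extendCurve_of_mem] at this

lemma memPredictableL2_of_isVersion {Ψ : ℝ≥0 → Ω → H} (hΨ : IsStronglyPredictable 𝓕 Ψ)
    (hΨΦ : IsVersion Ψ Φ) : MemPredictableL2 P 𝓕 T Ψ := by
  refine ⟨hΨ, ?_⟩
  rw [lintegral_prod_eq_eLpNorm_curve (hΨ.mono (predictable_le_prod 𝓕))
    fun s hs ↦ hΨΦ.ae_eq_extendCurve hs.2]
  exact ENNReal.pow_lt_top (memLp_extendCurve Φ).2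

variable [TopologicalSpace.SeparableSpace H]

/-- The bridge from processes to curves: by Tonelli the distance is computed time by time, where a
version may be replaced by Φ. -/
lemma lintegral_prod_version_sub_elementary {Ψ : ℝ≥0 → Ω → H} (hΨ : IsStronglyPredictable 𝓕 Ψ)
    (hΨΦ : IsVersion Ψ Φ) (X : ElementaryProcess 𝓕 H) :
    ∫⁻ p, ‖Ψ p.1 p.2 - X.toFun p.1 p.2‖ₑ ^ 2 ∂((lebesgue T).prod P)
      = eLpNorm (X.curve P - extendCurve Φ) 2 (lebesgue T) ^ 2 := by
  rw [eLpNorm_sub_comm]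
  refine lintegral_prod_eq_eLpNorm_curve (F := fun s ω ↦ Ψ s ω - X.toFun s ω)
    ((hΨ.mono (predictable_le_prod 𝓕)).sub
      (X.isStronglyPredictable.mono (predictable_le_prod 𝓕))) fun s hs ↦ ?_
  filter_upwards [hΨΦ.ae_eq_extendCurve hs.2, X.coeFn_curve (P := P) s,
    Lp.coeFn_sub (extendCurve Φ s) (X.curve P s)] with ω h1 h2 h3
  rw [Pi.sub_apply, h3, Pi.sub_apply, h1, h2]

/-- Cutting off at t does not increase the distance of the integrands, so one approximation on [0,T]
serves all t. -/
lemma tendsto_integral_of_tendsto_curve (hM : IsSqIntegrableLevyMartingale P 𝓕 M)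
    {X : ℕ → ElementaryProcess 𝓕 H}
    (hX : Tendsto (fun k ↦ eLpNorm ((X k).curve P - extendCurve Φ) 2 (lebesgue T)) atTop (𝓝 0))
    {t : ℝ≥0} (ht : t ≤ T) {A : Lp H 2 P}
    (hA : HasCurveIntegral P 𝓕 M T ((Iic t).indicator (extendCurve Φ)) A) :
    Tendsto (fun k ↦ ((X k).memLp_integral hM t).toLp ((X k).integral M t)) atTop (𝓝 A) := by
  rw [tendsto_iff_edist_tendsto_0]
  have h1 := ENNReal.Tendsto.const_mul (a := ENNReal.ofReal √(varianceRate P M)) hX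
    (Or.inr ENNReal.ofReal_ne_top)
  rw [mul_zero] at h1
  refine tendsto_of_tendsto_of_tendsto_of_le_of_le tendsto_const_nhds h1 (fun _ ↦ zero_le)
    fun k ↦ ?_
  simp only
  rw [edist_eq_enorm_sub, ((X k).hasCurveIntegral hM ht).enorm_sub hM hA, ← indicator_sub']
  gcongr
  exact eLpNorm_indicator_le _

/-- An Itô integral of a predictable version of `Φ` is a version of the curve integral. -/
lemma IsItoIntegral.isVersion (hM : IsSqIntegrableLevyMartingale P 𝓕 M)
    {Y : Icc (0 : ℝ≥0) T → Lp H 2 P}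
    (hY : ∀ t : Icc (0 : ℝ≥0) T,
      HasCurveIntegral P 𝓕 M T ((Iic (t : ℝ≥0)).indicator (extendCurve Φ)) (Y t))
    {Ψ I : ℝ≥0 → Ω → H} (hΨΦ : IsVersion Ψ Φ) (hI : IsItoIntegral P 𝓕 M T Ψ I) :
    IsVersion I Y := by
  obtain ⟨hΨ, hIm, -, X, hX, hXI⟩ := hI
  simp_rw [lintegral_prod_version_sub_elementary hΨ.1 hΨΦ] at hX
  intro t
  have hIt : AEStronglyMeasurable (I t) P :=
    ((hIm t t.2).mono (𝓕.le _)).aestronglyMeasurable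
  have h1 := tendsto_integral_of_tendsto_curve hM (tendsto_zero_of_tendsto_sq_zero hX) t.2.2 (hY t)
  rw [tendsto_iff_edist_tendsto_0] at h1
  have h2 := hXI t t.2
  simp_rw [lintegral_enorm_sq_eq] at h2
  have h3 := (tendsto_zero_of_tendsto_sq_zero h2).add h1
  rw [add_zero] at h3
  set y : Ω → H := ⇑(Y t)
  have hym : AEStronglyMeasurable y P := Lp.aestronglyMeasurable _
  -- Square integrability of `I t` is not part of the definition, so the triangle inequality is used
  -- for `eLpNorm` of functions and not in `Lp`.
  have h4 : eLpNorm (I t - y) 2 P ≤ 0 := by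
    refine ge_of_tendsto h3 (Eventually.of_forall fun k ↦ ?_)
    have hmem := (X k).memLp_integral hM t
    have h5 : edist (hmem.toLp _) (Y t) = eLpNorm ((X k).integral M t - y) 2 P := by
      rw [Lp.edist_def]
      refine eLpNorm_congr_ae ?_
      filter_upwards [hmem.coeFn_toLp] with ω h
      simp [h, y]
    rw [h5]
    have h6 : I t - y = (I t - (X k).integral M t) + ((X k).integral M t - y) := by abel
    rw [h6]
    exact eLpNorm_add_le (hIt.sub hmem.1) (hmem.1.sub hym) (by norm_num)
  have h7 := (eLpNorm_eq_zero_iff (hIt.sub hym) (by norm_num)).1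
    (le_antisymm h4 zero_le)
  filter_upwards [h7] with ω hω
  simpa [sub_eq_zero] using hω

/-- Summable `L²` distances imply almost sure convergence. -/
lemma ae_tendsto_of_tsum_enorm_sq_ne_top {f : ℕ → Ω → H} {F : ℕ → Lp H 2 P}
    {A : Lp H 2 P} (hf : ∀ k, f k =ᵐ[P] F k) (hF : ∑' k, ‖F k - A‖ₑ ^ 2 ≠ ∞) :
    ∀ᵐ ω ∂P, Tendsto (fun k ↦ f k ω) atTop (𝓝 (A ω)) := by
  have hmeas : ∀ k, AEMeasurable (fun ω ↦ ‖(F k - A : Lp H 2 P) ω‖ₑ ^ 2) P :=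
    fun k ↦ (Lp.aestronglyMeasurable _).enorm.pow_const 2
  have hsum : ∫⁻ ω, ∑' k, ‖(F k - A : Lp H 2 P) ω‖ₑ ^ 2 ∂P ≠ ∞ := by
    rw [lintegral_tsum hmeas]
    simp_rw [lintegral_enorm_sq_eq, ← Lp.enorm_def]
    exact hF
  have hfin := ae_lt_top' (AEMeasurable.tsum hmeas) hsum
  filter_upwards [hfin, ae_all_iff.2 hf, ae_all_iff.2 fun k ↦ Lp.coeFn_sub (F k) A]
    with ω h1 h2 h3
  have h4 := tendsto_zero_of_tendsto_sq_zero (ENNReal.tendsto_atTop_zero_of_tsum_ne_top h1.ne)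
  rw [tendsto_iff_edist_tendsto_0]
  refine h4.congr fun k ↦ ?_
  rw [h3 k, Pi.sub_apply, h2 k, edist_eq_enorm_sub]

/-- Any ratio below 1 would do here. The ratio 1/4 is chosen for the maximal inequality, where
squared norms of order 16^{-k} are divided by the squared threshold 4^{-k}. -/
lemma tsum_enorm_sq_ne_top {E : Type*} [NormedAddCommGroup E] {a : ℕ → E} {C : ℝ}
    (h : ∀ k, ‖a k‖ ≤ C * (1 / 4) ^ k) :
    ∑' k, ‖a k‖ₑ ^ 2 ≠ ∞ := by
  have hsum : Summable fun k : ℕ ↦ (C * (1 / 4) ^ k) ^ 2 := by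
    have : Summable fun k : ℕ ↦ C ^ 2 * (1 / 16 : ℝ) ^ k :=
      (summable_geometric_of_lt_one (by norm_num) (by norm_num)).mul_left _
    refine this.congr fun k ↦ ?_
    rw [mul_pow, ← pow_mul, mul_comm k 2, pow_mul]
    norm_num
  have hle : ∀ k, ‖a k‖ₑ ^ 2 ≤ ENNReal.ofReal ((C * (1 / 4) ^ k) ^ 2) := fun k ↦ by
    rw [← ofReal_norm, ← ENNReal.ofReal_pow (norm_nonneg _)]
    exact ENNReal.ofReal_le_ofReal (pow_le_pow_left₀ (norm_nonneg _) (h k) 2)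
  refine ne_top_of_le_ne_top ?_ (ENNReal.tsum_le_tsum hle)
  exact hsum.tsum_ofReal_ne_top

/-- An adapted curve has a predictable version. -/
lemma exists_predictable_version (hΦ : Φ ∈ Cad P 𝓕 H T) :
    ∃ Ψ : ℝ≥0 → Ω → H, IsStronglyPredictable 𝓕 Ψ ∧ IsVersion Ψ Φ := by
  choose X hX using fun k : ℕ ↦
    exists_elementary_near hΦ (show (0 : ℝ) < (1 / 4) ^ k by positivity)
  obtain ⟨ξ, hξ, hΦξ⟩ := hΦ ⟨0, zero_le, zero_le⟩
  -- Elementary processes vanish at time 0, so an 𝓕 0-measurable representative of Φ_0 is inserted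
  -- there; {0} × A with A in 𝓕 0 is predictable.
  refine ⟨fun s ω ↦ if s = 0 then ξ ω else limUnder atTop fun k ↦ (X k).toFun s ω, ?_, ?_⟩
  · have hlim : StronglyMeasurable[𝓕.predictable]
        (fun p : ℝ≥0 × Ω ↦ limUnder atTop fun k ↦ (X k).toFun p.1 p.2) :=
      @StronglyMeasurable.limUnder _ _ _ 𝓕.predictable _ _ _ _ _ _ _ fun k ↦ (X k).isStronglyPredictable
    have := UniformSpace.secondCountable_of_separable H
    borelize H
    refine Measurable.stronglyMeasurable fun B hB ↦ ?_
    have heq : (Function.uncurry fun s ω ↦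
        if s = 0 then ξ ω else limUnder atTop fun k ↦ (X k).toFun s ω) ⁻¹' B
        = ({⊥} ×ˢ (ξ ⁻¹' B)) ∪ (({⊥} ×ˢ univ)ᶜ ∩
          (fun p : ℝ≥0 × Ω ↦ limUnder atTop fun k ↦ (X k).toFun p.1 p.2) ⁻¹' B) := by
      ext p
      by_cases hp : p.1 = 0
      · simp [Function.uncurry, hp]
      · simp [Function.uncurry, hp]
    rw [heq]
    exact (measurableSet_predictable_singleton_bot_prod (hξ.measurable hB)).union
      ((measurableSet_predictable_singleton_bot_prod MeasurableSet.univ).compl.inter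
        (hlim.measurable hB))
  · intro t
    rcases eq_or_lt_of_le t.2.1 with h | h
    · have ht : t = ⟨0, zero_le, zero_le⟩ := Subtype.ext h.symm
      subst ht
      filter_upwards [hΦξ] with ω hω
      simp [hω]
    · have hne : (t : ℝ≥0) ≠ 0 := h.ne'
      have := ae_tendsto_of_tsum_enorm_sq_ne_top (fun k ↦ ((X k).coeFn_curve (P := P) t).symm)
        (tsum_enorm_sq_ne_top (C := 1) fun k ↦ by
          simpa using hX k t ⟨h, t.2.2⟩)
      filter_upwards [this] with ω hω
      simp only [hne, if_false]
      rw [hω.limUnder_eq, extendCurve_of_mem]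

end Integrals

/-! ### Càdlàg paths: algebra, uniform limits, dyadic times. -/

section Cadlag

variable {E : Type*} [NormedAddCommGroup E] {S : Set ℝ≥0} {x y : ℝ≥0 → E}

lemma CadlagOn.zero : CadlagOn (fun _ ↦ (0 : E)) S :=
  fun _ _ ↦ ⟨continuousWithinAt_const, 0, tendsto_const_nhds⟩

lemma CadlagOn.add (hx : CadlagOn x S) (hy : CadlagOn y S) : CadlagOn (fun t ↦ x t + y t) S := by
  intro t ht
  obtain ⟨hx1, l, hl⟩ := hx t ht
  obtain ⟨hy1, l', hl'⟩ := hy t ht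
  exact ⟨hx1.add hy1, l + l', hl.add hl'⟩

lemma CadlagOn.sub (hx : CadlagOn x S) (hy : CadlagOn y S) : CadlagOn (fun t ↦ x t - y t) S := by
  intro t ht
  obtain ⟨hx1, l, hl⟩ := hx t ht
  obtain ⟨hy1, l', hl'⟩ := hy t ht
  exact ⟨hx1.sub hy1, l - l', hl.sub hl'⟩

lemma CadlagOn.smul_const [NormedSpace ℝ E] {z : ℝ≥0 → ℝ} (hz : CadlagOn z S) (c : E) :
    CadlagOn (fun t ↦ z t • c) S := by
  intro t ht
  obtain ⟨hz1, l, hl⟩ := hz t ht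
  exact ⟨hz1.smul_const c, l • c, hl.smul_const c⟩

lemma CadlagOn.sum {ι : Type*} (s : Finset ι) {f : ι → ℝ≥0 → E} (hf : ∀ i, CadlagOn (f i) S) :
    CadlagOn (fun t ↦ ∑ i ∈ s, f i t) S := by
  classical
  induction s using Finset.induction_on with
  | empty => simpa using CadlagOn.zero
  | insert a s ha ih =>
    simp_rw [Finset.sum_insert ha]
    exact (hf a).add ih

/-- A càdlàg path stopped at a fixed time is càdlàg. -/
lemma CadlagOn.comp_min_left (hx : CadlagOn x univ) (v : ℝ≥0) (S : Set ℝ≥0) :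
    CadlagOn (fun t ↦ x (min v t)) S := by
  intro t _
  constructor
  · refine (hx (min v t) (mem_univ _)).1.comp (f := fun t ↦ min v t)
      (by fun_prop : Continuous fun t : ℝ≥0 ↦ min v t).continuousWithinAt ?_
    rintro r ⟨-, hr⟩
    exact ⟨mem_univ _, min_le_min_left v hr⟩
  · rcases le_or_gt t v with h | h
    · obtain ⟨l, hl⟩ := (hx t (mem_univ _)).2
      refine ⟨l, (hl.mono_left (nhdsWithin_mono _ fun r hr ↦ ⟨mem_univ _, hr.2⟩)).congr' ?_⟩
      filter_upwards [self_mem_nhdsWithin] with r hr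
      rw [min_eq_right (hr.2.le.trans h)]
    · refine ⟨x v, tendsto_const_nhds.congr' ?_⟩
      filter_upwards [mem_nhdsWithin_of_mem_nhds (Ioi_mem_nhds h)] with r hr
      rw [min_eq_left (le_of_lt hr)]

/-- A uniform limit of càdlàg paths is càdlàg. -/
lemma CadlagOn.of_uniform_approx [CompleteSpace E]
    (h : ∀ ε > 0, ∃ y : ℝ≥0 → E, CadlagOn y S ∧ ∀ t ∈ S, dist (x t) (y t) < ε) :
    CadlagOn x S := by
  intro t ht
  constructor
  · refine continuousWithinAt_of_locally_uniform_approx_of_continuousWithinAt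
      ⟨ht, self_mem_Ici⟩ fun u hu ↦ ?_
    obtain ⟨ε, hε, hu⟩ := Metric.mem_uniformity_dist.1 hu
    obtain ⟨y, hy, hxy⟩ := h ε hε
    exact ⟨_, self_mem_nhdsWithin, y, (hy t ht).1, fun r hr ↦ hu (hxy r hr.1)⟩
  -- If no points of S accumulate at t from the left, as at t = 0, any value is a left limit.
  · rcases (𝓝[S ∩ Iio t] t).eq_or_neBot with hbot | hne
    · exact ⟨0, by rw [hbot]; exact tendsto_bot⟩
    refine cauchy_map_iff_exists_tendsto.1 (Metric.cauchy_iff.2 ⟨inferInstance, fun ε hε ↦ ?_⟩)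
    obtain ⟨y, hy, hxy⟩ := h (ε / 3) (by positivity)
    obtain ⟨l, hl⟩ := (hy t ht).2
    obtain ⟨V, hV, hVd⟩ := (Metric.cauchy_iff.1 hl.cauchy_map).2 (ε / 3) (by positivity)
    refine ⟨x '' (y ⁻¹' V ∩ (S ∩ Iio t)),
      image_mem_map (inter_mem hV self_mem_nhdsWithin), ?_⟩
    rintro _ ⟨r, ⟨hrV, hrS, -⟩, rfl⟩ _ ⟨q, ⟨hqV, hqS, -⟩, rfl⟩
    have h1 := hxy r hrS
    have h2 := hxy q hqS
    have h3 := hVd _ hrV _ hqV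
    have h4 := dist_triangle4 (x r) (y r) (y q) (x q)
    rw [dist_comm (y q)] at h4
    linarith

/-- A sequence of càdlàg paths whose consecutive uniform distances are eventually dominated by a
geometric sequence converges to a càdlàg path. -/
lemma exists_cadlag_limit [CompleteSpace E] {f : ℕ → ℝ≥0 → E} (hf : ∀ k, CadlagOn (f k) S)
    (hd : ∀ᶠ k in atTop, ∀ t ∈ S, dist (f k t) (f (k + 1) t) ≤ (1 / 2) ^ k) :
    ∃ g : ℝ≥0 → E, CadlagOn g S ∧ ∀ t ∈ S, Tendsto (fun k ↦ f k t) atTop (𝓝 (g t)) := by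
  obtain ⟨k₀, hk₀⟩ := eventually_atTop.1 hd
  have hgeo : ∀ t ∈ S, ∀ j, dist (f (j + k₀) t) (f (j + 1 + k₀) t)
      ≤ (1 / 2) ^ k₀ * (1 / 2) ^ j := fun t ht j ↦ by
    rw [← pow_add, add_comm k₀, add_right_comm]
    exact hk₀ _ (by omega) t ht
  have hlim : ∀ t ∈ S, ∃ l, Tendsto (fun k ↦ f k t) atTop (𝓝 l) := fun t ht ↦ by
    obtain ⟨l, hl⟩ := cauchySeq_tendsto_of_complete
      (cauchySeq_of_le_geometric (1 / 2) ((1 / 2) ^ k₀) (by norm_num) (hgeo t ht))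
    exact ⟨l, (tendsto_add_atTop_iff_nat k₀).1 hl⟩
  choose! g hg using hlim
  refine ⟨g, CadlagOn.of_uniform_approx fun ε hε ↦ ?_, hg⟩
  have hsmall : Tendsto (fun j : ℕ ↦ (1 / 2 : ℝ) ^ k₀ * (1 / 2) ^ j / (1 - 1 / 2)) atTop (𝓝 0) := by
    have := ((tendsto_pow_atTop_nhds_zero_of_lt_one (r := (1 / 2 : ℝ)) (by norm_num)
      (by norm_num)).const_mul ((1 / 2 : ℝ) ^ k₀)).div_const (1 - 1 / 2)
    simpa using this
  obtain ⟨j, hj⟩ := (hsmall.eventually (gt_mem_nhds hε)).exists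
  refine ⟨f (j + k₀), hf _, fun t ht ↦ ?_⟩
  rw [dist_comm]
  exact (dist_le_of_le_geometric_of_tendsto (1 / 2) ((1 / 2) ^ k₀) (by norm_num) (hgeo t ht)
    ((tendsto_add_atTop_iff_nat k₀).2 (hg t ht)) j).trans_lt hj

/-- A right-continuous path on `[0,T]` that is large somewhere is large at a dyadic time. -/
lemma CadlagOn.exists_dyadic_lt {T : ℝ≥0} (hx : CadlagOn x (Icc 0 T)) {c : ℝ} {t : ℝ≥0}
    (ht : t ≤ T) (hc : c < ‖x t‖) :
    ∃ n k : ℕ, k ≤ 2 ^ n ∧ c < ‖x (k * (T / 2 ^ n))‖ := by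
  rcases eq_or_lt_of_le (zero_le : 0 ≤ T) with hT | hT
  · refine ⟨0, 0, by norm_num, ?_⟩
    have : t = 0 := le_antisymm (hT ▸ ht) zero_le
    simpa [this] using hc
  have hnear : ∀ᶠ r in 𝓝[Icc 0 T ∩ Ici t] t, c < ‖x r‖ :=
    (hx t ⟨zero_le, ht⟩).1.norm.eventually (lt_mem_nhds hc)
  obtain ⟨δ, hδ, hball⟩ := Metric.mem_nhdsWithin_iff.1 hnear
  obtain ⟨n, hn⟩ : ∃ n : ℕ, (T : ℝ) / 2 ^ n < δ := by
    obtain ⟨n, hn⟩ := exists_pow_lt_of_lt_one (show 0 < δ / (T + 1) by positivity)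
      (show (1 / 2 : ℝ) < 1 by norm_num)
    refine ⟨n, ?_⟩
    rw [lt_div_iff₀ (by positivity), one_div, inv_pow] at hn
    rw [div_eq_inv_mul]
    have : (0 : ℝ) < (2 ^ n)⁻¹ := by positivity
    nlinarith
  have hh : 0 < T / 2 ^ n := by positivity
  -- The first grid point at or after t: within one grid step to the right of t, and at most T
  -- because T is on the grid.
  have hk1 : t ≤ ⌈t / (T / 2 ^ n)⌉₊ * (T / 2 ^ n) := by
    rw [← div_le_iff₀ hh]
    exact Nat.le_ceil _
  have hk2 : ⌈t / (T / 2 ^ n)⌉₊ * (T / 2 ^ n) < t + T / 2 ^ n := by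
    have := Nat.ceil_lt_add_one (zero_le : 0 ≤ t / (T / 2 ^ n))
    calc (⌈t / (T / 2 ^ n)⌉₊ : ℝ≥0) * (T / 2 ^ n) < (t / (T / 2 ^ n) + 1) * (T / 2 ^ n) := by
          gcongr
      _ = t + T / 2 ^ n := by
          field_simp
  have hk3 : ⌈t / (T / 2 ^ n)⌉₊ ≤ 2 ^ n := by
    rw [Nat.ceil_le, div_le_iff₀ hh]
    push_cast
    rwa [mul_div_cancel₀ _ (by positivity)]
  refine ⟨n, _, hk3, hball ⟨?_, ⟨zero_le, ?_⟩, hk1⟩⟩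
  · rw [Metric.mem_ball, NNReal.dist_eq, abs_of_nonneg (sub_nonneg.2 (by exact_mod_cast hk1))]
    have : ((⌈t / (T / 2 ^ n)⌉₊ * (T / 2 ^ n) : ℝ≥0) : ℝ) < t + T / 2 ^ n := by exact_mod_cast hk2
    linarith
  · calc (⌈t / (T / 2 ^ n)⌉₊ : ℝ≥0) * (T / 2 ^ n) ≤ 2 ^ n * (T / 2 ^ n) := by
          gcongr
          exact_mod_cast hk3
      _ = T := mul_div_cancel₀ _ (by positivity)

end Cadlag

/-! ### Doob's maximal inequality for elementary integrals. -/

section Maximal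

variable {Ω : Type*} {mΩ : MeasurableSpace Ω} {P : Measure Ω} [IsProbabilityMeasure P]
  {𝓕 : Filtration ℝ≥0 mΩ} {M : ℝ≥0 → Ω → ℝ}
  {H : Type*} [NormedAddCommGroup H] [InnerProductSpace ℝ H] [CompleteSpace H] {T : ℝ≥0}

/-- A square-integrable adapted `H`-valued process whose increments are orthogonal to the past. -/
structure HasOrthogonalIncrements (P : Measure Ω) (𝓕 : Filtration ℝ≥0 mΩ) (N : ℝ≥0 → Ω → H) :
    Prop where
  stronglyMeasurable : ∀ t, StronglyMeasurable[𝓕 t] (N t)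
  memLp : ∀ t, MemLp (N t) 2 P
  integral_inner : ∀ s t, s ≤ t → ∀ ζ : Ω → H, StronglyMeasurable[𝓕 s] ζ → MemLp ζ 2 P →
    ∫ ω, inner ℝ (ζ ω) (N t ω - N s ω) ∂P = 0

namespace HasOrthogonalIncrements

variable {N : ℝ≥0 → Ω → H}

lemma sub {N' : ℝ≥0 → Ω → H} (hN : HasOrthogonalIncrements P 𝓕 N)
    (hN' : HasOrthogonalIncrements P 𝓕 N') :
    HasOrthogonalIncrements P 𝓕 (fun t ω ↦ N t ω - N' t ω) where
  stronglyMeasurable t := (hN.stronglyMeasurable t).sub (hN'.stronglyMeasurable t)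
  memLp t := (hN.memLp t).sub (hN'.memLp t)
  integral_inner s t hst ζ hζ hζ2 := by
    have h1 : ∀ ω, inner ℝ (ζ ω) (N t ω - N' t ω - (N s ω - N' s ω))
        = inner ℝ (ζ ω) (N t ω - N s ω) - inner ℝ (ζ ω) (N' t ω - N' s ω) := fun ω ↦ by
      rw [← inner_sub_right]
      congr 1
      abel
    simp_rw [h1]
    rw [integral_sub (f := fun ω ↦ inner ℝ (ζ ω) (N t ω - N s ω))
      (g := fun ω ↦ inner ℝ (ζ ω) (N' t ω - N' s ω))
      (integrable_inner_of_memLp hζ2 ((hN.memLp t).sub (hN.memLp s)))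
      (integrable_inner_of_memLp hζ2 ((hN'.memLp t).sub (hN'.memLp s))),
      hN.integral_inner s t hst ζ hζ hζ2, hN'.integral_inner s t hst ζ hζ hζ2, sub_zero]

/-- Expand ‖N_t‖² around N_s: the cross term integrates to zero over A, by orthogonality tested
against 1_A N_s. This is the submartingale property of ‖N‖². -/
lemma setIntegral_norm_sq_le (hN : HasOrthogonalIncrements P 𝓕 N) {s t : ℝ≥0} (hst : s ≤ t)
    {A : Set Ω} (hA : MeasurableSet[𝓕 s] A) :
    ∫ ω in A, ‖N s ω‖ ^ 2 ∂P ≤ ∫ ω in A, ‖N t ω‖ ^ 2 ∂P := by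
  have hA' : MeasurableSet A := 𝓕.le s A hA
  have hint : ∀ r, Integrable (fun ω ↦ ‖N r ω‖ ^ 2) P := fun r ↦
    (memLp_two_iff_integrable_sq_norm (hN.memLp r).1).1 (hN.memLp r)
  have hcross := hN.integral_inner s t hst (A.indicator (N s))
    ((hN.stronglyMeasurable s).indicator hA) ((hN.memLp s).indicator hA')
  have hcross' : ∫ ω in A, inner ℝ (N s ω) (N t ω - N s ω) ∂P = 0 := by
    rw [← hcross, ← integral_indicator hA']
    congr 1 with ω
    by_cases hω : ω ∈ A <;> simp [hω]
  have hcint : Integrable (fun ω ↦ inner ℝ (N s ω) (N t ω - N s ω)) P :=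
    integrable_inner_of_memLp (hN.memLp s) ((hN.memLp t).sub (hN.memLp s))
  calc ∫ ω in A, ‖N s ω‖ ^ 2 ∂P
      = ∫ ω in A, ‖N s ω‖ ^ 2 + 2 * inner ℝ (N s ω) (N t ω - N s ω) ∂P := by
        rw [integral_add (hint s).integrableOn (hcint.const_mul 2).integrableOn,
          integral_const_mul, hcross', mul_zero, add_zero]
    _ ≤ ∫ ω in A, ‖N t ω‖ ^ 2 ∂P := by
        refine integral_mono ((hint s).add (hcint.const_mul 2)).integrableOn
          (hint t).integrableOn fun ω ↦ ?_
        have h1 := norm_add_sq_real (N s ω) (N t ω - N s ω)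
        rw [add_sub_cancel] at h1
        simp only
        rw [h1]
        nlinarith [sq_nonneg ‖N t ω - N s ω‖]

/-- Doob's maximal inequality along a finite increasing family of times. -/
lemma maximal_grid (hN : HasOrthogonalIncrements P 𝓕 N) {g : ℕ → ℝ≥0} (hg : Monotone g)
    (ε : ℝ≥0) (n : ℕ) :
    ε * P {ω | ∃ k ≤ n, (ε : ℝ) ≤ ‖N (g k) ω‖ ^ 2} ≤ ∫⁻ ω, ‖N (g n) ω‖ₑ ^ 2 ∂P := by
  let 𝒢 : Filtration ℕ mΩ :=
    { seq := fun k ↦ 𝓕 (g k)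
      mono' := fun i j hij ↦ 𝓕.mono (hg hij)
      le' := fun k ↦ 𝓕.le _ }
  have hint : ∀ k, Integrable (fun ω ↦ ‖N (g k) ω‖ ^ 2) P := fun k ↦
    (memLp_two_iff_integrable_sq_norm (hN.memLp (g k)).1).1 (hN.memLp (g k))
  have hsub : Submartingale (fun k ω ↦ ‖N (g k) ω‖ ^ 2) 𝒢 P :=
    submartingale_of_setIntegral_le
      (fun k ↦ (continuous_norm.pow 2).comp_stronglyMeasurable (hN.stronglyMeasurable (g k)))
      hint fun i j hij A hA ↦ hN.setIntegral_norm_sq_le (hg hij) hA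
  have hmax := maximal_ineq hsub (fun k ω ↦ sq_nonneg _) (ε := ε) n
  have hset : {ω | ∃ k ≤ n, (ε : ℝ) ≤ ‖N (g k) ω‖ ^ 2} = {ω | (ε : ℝ) ≤
      (Finset.range (n + 1)).sup' Finset.nonempty_range_add_one fun k ↦ ‖N (g k) ω‖ ^ 2} := by
    ext ω
    simp [Finset.le_sup'_iff]
  rw [hset]
  refine hmax.trans ?_
  calc _ ≤ ENNReal.ofReal (∫ ω, ‖N (g n) ω‖ ^ 2 ∂P) :=
        ENNReal.ofReal_le_ofReal (setIntegral_le_integral (hint n)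
          (Eventually.of_forall fun ω ↦ sq_nonneg _))
    _ = ∫⁻ ω, ‖N (g n) ω‖ₑ ^ 2 ∂P := by
        rw [ofReal_integral_eq_lintegral_ofReal (hint n)
          (Eventually.of_forall fun ω ↦ sq_nonneg _)]
        congr 1 with ω
        rw [ENNReal.ofReal_pow (norm_nonneg _), ofReal_norm]

/-- Doob's maximal inequality on `[0,T]` for càdlàg paths. -/
lemma maximal_cadlag (hN : HasOrthogonalIncrements P 𝓕 N)
    (hcad : ∀ᵐ ω ∂P, CadlagOn (fun t ↦ N t ω) (Icc 0 T)) {c : ℝ≥0} (hc : 0 < c) :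
    P {ω | ∃ t ≤ T, (c : ℝ) < ‖N t ω‖} ≤ (∫⁻ ω, ‖N T ω‖ₑ ^ 2 ∂P) / (c ^ 2 : ℝ≥0) := by
  have hc2 : ((c ^ 2 : ℝ≥0) : ℝ≥0∞) ≠ 0 := by
    simpa using hc.ne'
  let D : ℕ → Set Ω := fun n ↦
    {ω | ∃ k : ℕ, k ≤ 2 ^ n ∧ ((c ^ 2 : ℝ≥0) : ℝ) ≤ ‖N (k * (T / 2 ^ n)) ω‖ ^ 2}
  have hD : ∀ n, P (D n) ≤ (∫⁻ ω, ‖N T ω‖ₑ ^ 2 ∂P) / (c ^ 2 : ℝ≥0) := by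
    intro n
    have := hN.maximal_grid (g := fun k ↦ k * (T / 2 ^ n)) (fun i j hij ↦ by
      simp only
      gcongr) (c ^ 2) (2 ^ n)
    rw [ENNReal.le_div_iff_mul_le (Or.inl hc2) (Or.inl ENNReal.coe_ne_top), mul_comm]
    have hT : ((2 ^ n : ℕ) : ℝ≥0) * (T / 2 ^ n) = T := by
      push_cast
      exact mul_div_cancel₀ _ (by positivity)
    simp only [hT] at this
    exact this
  -- Dyadic grids are nested, so the events increase and continuity from below applies.
  have hmono : Monotone D := by
    refine monotone_nat_of_le_succ fun n ω ↦ ?_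
    rintro ⟨k, hk, hω⟩
    refine ⟨2 * k, by rw [pow_succ]; omega, ?_⟩
    have : ((2 * k : ℕ) : ℝ≥0) * (T / 2 ^ (n + 1)) = k * (T / 2 ^ n) := by
      push_cast
      rw [pow_succ]
      field_simp
    rwa [this]
  have hUnion : P (⋃ n, D n) ≤ (∫⁻ ω, ‖N T ω‖ₑ ^ 2 ∂P) / (c ^ 2 : ℝ≥0) := by
    rw [hmono.measure_iUnion]
    exact iSup_le hD
  -- The strict inequality is an open condition, so right-continuity carries it to a nearby dyadic
  -- time.
  refine (measure_mono_ae ?_).trans hUnion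
  filter_upwards [hcad] with ω hω
  rintro ⟨t, ht, hct⟩
  obtain ⟨n, k, hk, hlt⟩ := hω.exists_dyadic_lt ht hct
  refine mem_iUnion.2 ⟨n, k, hk, ?_⟩
  push_cast
  exact pow_le_pow_left₀ c.2 hlt.le 2

end HasOrthogonalIncrements

lemma ElementaryProcess.hasOrthogonalIncrements (hM : IsSqIntegrableLevyMartingale P 𝓕 M)
    (X : ElementaryProcess 𝓕 H) : HasOrthogonalIncrements P 𝓕 (X.integral M) where
  stronglyMeasurable := X.stronglyMeasurable_integral hM
  memLp := X.memLp_integral hM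
  integral_inner s t hst ζ hζ hζ2 := by
    -- (a i, b i] is (u i, v i] ∩ (s, t]; the outer maximum in `b` collapses it when the
    -- intersection is empty. Since s ≤ a i, both ζ and ξ i are known at time a i.
    set a : Fin X.n → ℝ≥0 := fun i ↦ max (X.u i) s
    set b : Fin X.n → ℝ≥0 := fun i ↦ max (min (X.v i) t) (max (X.u i) s)
    have hdiff : ∀ ω, X.integral M t ω - X.integral M s ω
        = ∑ i, (M (b i) ω - M (a i) ω) • X.ξ i ω := by
      intro ω
      rw [integral, integral, ← Finset.sum_sub_distrib]
      refine Finset.sum_congr rfl fun i _ ↦ ?_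
      rw [← sub_smul]
      congr 1
      have huv := X.u_le_v i
      simp only [a, b]
      rcases le_total (X.u i) s with h | h
      · rw [max_eq_right h, min_eq_left h, min_eq_left (h.trans hst)]
        rcases le_total (X.v i) s with h' | h'
        · rw [min_eq_left h', min_eq_left (h'.trans hst), max_eq_right h']
          ring
        · rw [min_eq_right h', max_eq_left (le_min h' hst)]
          ring
      · rw [max_eq_left h, min_eq_right h, min_eq_right (h.trans huv)]
        rcases le_total (X.u i) t with h' | h'
        · rw [min_eq_left h', max_eq_left (le_min huv h')]
          ring
        · rw [min_eq_right h', min_eq_right (h'.trans huv), max_eq_right h']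
          ring
    have hξ : ∀ i, AEStronglyMeasurable[𝓕 (a i)] (X.ξ i) P := fun i ↦
      ((X.measurable_ξ i).mono (𝓕.mono (le_max_left _ _))).aestronglyMeasurable
    have hζ' : ∀ i, AEStronglyMeasurable[𝓕 (a i)] ζ P := fun i ↦
      (hζ.mono (𝓕.mono (le_max_right _ _))).aestronglyMeasurable
    simp_rw [hdiff, inner_sum]
    rw [integral_finsetSum _ fun i _ ↦ integrable_inner_of_memLp hζ2
      (hM.memLp_increment_smul (le_max_right _ _) (hξ i) (X.memLp_ξ i))]
    exact Finset.sum_eq_zero fun i _ ↦ hM.integral_inner_increment_smul_eq_zero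
      (le_max_right _ _) (hζ' i) hζ2 (hξ i) (X.memLp_ξ i)

lemma ElementaryProcess.cadlagOn_integral (X : ElementaryProcess 𝓕 H) {ω : Ω}
    (hω : CadlagOn (fun t ↦ M t ω) univ) (S : Set ℝ≥0) :
    CadlagOn (fun t ↦ X.integral M t ω) S :=
  CadlagOn.sum _ fun i ↦ ((hω.comp_min_left (X.v i) S).sub (hω.comp_min_left (X.u i) S)).smul_const (X.ξ i ω)

end Maximal

/-! ### Almost sure uniform convergence and existence of the Itô integral. -/

section CadlagVersion

variable {Ω : Type*} {mΩ : MeasurableSpace Ω} {P : Measure Ω} [IsProbabilityMeasure P]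
  {𝓕 : Filtration ℝ≥0 mΩ} {M : ℝ≥0 → Ω → ℝ}
  {H : Type*} [NormedAddCommGroup H] [InnerProductSpace ℝ H] [CompleteSpace H] {T : ℝ≥0}
  {Φ : C(Icc (0 : ℝ≥0) T, Lp H 2 P)}

/-- The elementary integrals of a geometrically fast approximation of `Φ` almost surely have
geometrically small uniform consecutive distances. -/
lemma ae_eventually_dist_integral_le (hM : IsSqIntegrableLevyMartingale P 𝓕 M)
    {X : ℕ → ElementaryProcess 𝓕 H}
    (hX : ∀ k, ∀ s ∈ Ioc 0 T, ‖(X k).curve P s - extendCurve Φ s‖ ≤ (1 / 4) ^ k) :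
    ∀ᵐ ω ∂P, ∀ᶠ k in atTop, ∀ t ∈ Icc 0 T,
      dist ((X k).integral M t ω) ((X (k + 1)).integral M t ω) ≤ (1 / 2) ^ k := by
  set K := curveIntegralConst P M T
  have hK : 0 ≤ K := curveIntegralConst_nonneg
  have hnorm : ∀ k, ∫⁻ ω, ‖(X k).integral M T ω - (X (k + 1)).integral M T ω‖ₑ ^ 2 ∂P
      ≤ ENNReal.ofReal ((K * (2 * (1 / 4) ^ k)) ^ 2) := by
    intro k
    rw [lintegral_enorm_sub_sq_eq ((X k).memLp_integral hM T).coeFn_toLp.symm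
      ((X (k + 1)).memLp_integral hM T).coeFn_toLp.symm, ← ofReal_norm,
      ← ENNReal.ofReal_pow (norm_nonneg _)]
    refine ENNReal.ofReal_le_ofReal (pow_le_pow_left₀ (norm_nonneg _) ?_ 2)
    refine ((X k).hasCurveIntegral hM le_rfl).norm_sub_le hM ((X (k + 1)).hasCurveIntegral hM le_rfl)
      (by positivity) fun s hs ↦ ?_
    rw [indicator_of_mem (mem_Iic.2 hs.2), indicator_of_mem (mem_Iic.2 hs.2)]
    have h1 := hX k s hs
    have h2 := hX (k + 1) s hs
    have h3 := norm_sub_le_norm_sub_add_norm_sub ((X k).curve P s) (extendCurve Φ s)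
      ((X (k + 1)).curve P s)
    rw [norm_sub_rev (extendCurve Φ s)] at h3
    rw [pow_succ] at h2
    have h4 : (0 : ℝ) < (1 / 4) ^ k := by positivity
    linarith
  -- Doob with threshold c = 2^{-k}: (2K)² 16^{-k} divided by 4^{-k}. This is summable, so
  -- Borel–Cantelli applies.
  have hbound : ∀ k, P {ω | ∃ t ≤ T, (((1 / 2) ^ k : ℝ≥0) : ℝ)
      < ‖(X k).integral M t ω - (X (k + 1)).integral M t ω‖}
      ≤ ENNReal.ofReal ((2 * K) ^ 2 * (1 / 4) ^ k) := by
    intro k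
    have hmax := (((X k).hasOrthogonalIncrements hM).sub
      ((X (k + 1)).hasOrthogonalIncrements hM)).maximal_cadlag (T := T) (by
        filter_upwards [hM.cadlag] with ω hω
        exact ((X k).cadlagOn_integral hω _).sub ((X (k + 1)).cadlagOn_integral hω _))
      (c := (1 / 2) ^ k) (by positivity)
    refine hmax.trans (ENNReal.div_le_of_le_mul ((hnorm k).trans_eq ?_))
    rw [← ENNReal.ofReal_coe_nnreal, ← ENNReal.ofReal_mul (by positivity)]
    congr 1
    push_cast
    have h1 : ((1 / 2 : ℝ) ^ k) ^ 2 = (1 / 4) ^ k := by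
      rw [← pow_mul, mul_comm, pow_mul]
      norm_num
    rw [h1]
    ring
  have hsum : ∑' k, P {ω | ∃ t ≤ T, (((1 / 2) ^ k : ℝ≥0) : ℝ)
      < ‖(X k).integral M t ω - (X (k + 1)).integral M t ω‖} ≠ ∞ := by
    refine ne_top_of_le_ne_top ?_ (ENNReal.tsum_le_tsum hbound)
    exact ((summable_geometric_of_lt_one (by norm_num) (by norm_num)).mul_left _).tsum_ofReal_ne_top
  filter_upwards [ae_eventually_notMem hsum] with ω hω
  filter_upwards [hω] with k hk t ht
  rw [dist_eq_norm]
  by_contra! hlt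
  exact hk ⟨t, ht.2, by push_cast; exact hlt⟩

variable [TopologicalSpace.SeparableSpace H]

/-- Existence of the Itô integral of a predictable version of an adapted curve. -/
lemma exists_isItoIntegral (h𝓕 : UsualConditions P 𝓕) (hM : IsSqIntegrableLevyMartingale P 𝓕 M)
    (hΦ : Φ ∈ Cad P 𝓕 H T) {Ψ : ℝ≥0 → Ω → H} (hΨ : IsStronglyPredictable 𝓕 Ψ)
    (hΨΦ : IsVersion Ψ Φ) : ∃ I : ℝ≥0 → Ω → H, IsItoIntegral P 𝓕 M T Ψ I := by
  choose X hX using fun k : ℕ ↦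
    exists_elementary_near hΦ (show (0 : ℝ) < (1 / 4) ^ k by positivity)
  have hXlim : Tendsto (fun k ↦ eLpNorm ((X k).curve P - extendCurve Φ) 2 (lebesgue T)) atTop
      (𝓝 0) :=
    tendsto_eLpNorm_lebesgue hX (tendsto_pow_atTop_nhds_zero_of_lt_one (by norm_num) (by norm_num))
  have hgood := hM.cadlag.and (ae_eventually_dist_integral_le hM hX)
  set G : Set Ω := {ω | CadlagOn (fun t ↦ M t ω) univ ∧ ∀ᶠ k in atTop, ∀ t ∈ Icc 0 T,
    dist ((X k).integral M t ω) ((X (k + 1)).integral M t ω) ≤ (1 / 2) ^ k}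
  -- The exceptional set is null, hence in 𝓕 0 by completeness. Setting the process to zero there
  -- keeps it adapted and makes every path càdlàg.
  have hG : MeasurableSet[𝓕 0] G := by
    rw [← compl_compl G]
    exact (h𝓕.complete Gᶜ hgood).compl
  have hpath : ∀ ω ∈ G, ∃ g : ℝ≥0 → H, CadlagOn g (Icc 0 T) ∧
      ∀ t ∈ Icc 0 T, Tendsto (fun k ↦ (X k).integral M t ω) atTop (𝓝 (g t)) := fun ω hω ↦
    exists_cadlag_limit (fun k ↦ (X k).cadlagOn_integral hω.1 _) hω.2
  let I : ℝ≥0 → Ω → H := fun t ↦ G.indicator fun ω ↦ limUnder atTop fun k ↦ (X k).integral M t ω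
  have hIlim : ∀ ω ∈ G, ∀ t ∈ Icc 0 T,
      Tendsto (fun k ↦ (X k).integral M t ω) atTop (𝓝 (I t ω)) := by
    intro ω hω t ht
    obtain ⟨g, -, hg⟩ := hpath ω hω
    simp only [I, indicator_of_mem hω]
    rw [(hg t ht).limUnder_eq]
    exact hg t ht
  refine ⟨I, memPredictableL2_of_isVersion hΨ hΨΦ, fun t _ ↦ ?_, fun ω ↦ ?_, X, ?_, fun t ht ↦ ?_⟩
  · refine StronglyMeasurable.indicator ?_ (𝓕.mono zero_le _ hG)
    exact @StronglyMeasurable.limUnder _ _ _ (𝓕 t) _ _ _ _ _ _ _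
      fun k ↦ (X k).stronglyMeasurable_integral hM t
  · by_cases hω : ω ∈ G
    · obtain ⟨g, hgc, hg⟩ := hpath ω hω
      have heq : ∀ t ∈ Icc 0 T, I t ω = g t := fun t ht ↦
        tendsto_nhds_unique (hIlim ω hω t ht) (hg t ht)
      -- Approximation at distance zero transfers the càdlàg property between paths that agree only
      -- on [0,T].
      refine CadlagOn.of_uniform_approx fun ε hε ↦ ⟨g, hgc, fun t ht ↦ ?_⟩
      rw [heq t ht, dist_self]
      exact hε
    · simp only [I, indicator_of_notMem hω]
      exact CadlagOn.zero
  · simp_rw [lintegral_prod_version_sub_elementary hΨ hΨΦ]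
    have := (ENNReal.continuous_pow 2).tendsto 0 |>.comp hXlim
    simpa [Function.comp_def] using this
  · obtain ⟨A, hA, -⟩ := exists_hasCurveIntegral hM hΦ ht.2
    have hlim := tendsto_integral_of_tendsto_curve hM hXlim ht.2 hA
    have hae : I t =ᵐ[P] A := by
      have h1 := ae_tendsto_of_tsum_enorm_sq_ne_top (A := A)
        (fun k ↦ ((X k).memLp_integral hM t).coeFn_toLp.symm)
        (tsum_enorm_sq_ne_top (C := curveIntegralConst P M T) fun k ↦
          ((X k).hasCurveIntegral hM ht.2).norm_sub_le hM hA (by positivity) fun s hs ↦ by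
            by_cases hst : s ∈ Iic t
            · rw [indicator_of_mem hst, indicator_of_mem hst]
              exact hX k s hs
            · rw [indicator_of_notMem hst, indicator_of_notMem hst, sub_self, norm_zero]
              positivity)
      filter_upwards [h1, hgood] with ω h2 h3
      exact tendsto_nhds_unique (hIlim ω h3 t ht) h2
    have hedist := tendsto_iff_edist_tendsto_0.1 hlim
    have hsq := (ENNReal.continuous_pow 2).tendsto 0 |>.comp hedist
    rw [zero_pow (by norm_num)] at hsq
    refine hsq.congr fun k ↦ ?_
    rw [lintegral_enorm_sub_sq_eq hae ((X k).memLp_integral hM t).coeFn_toLp.symm,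
      Function.comp_apply, edist_comm, edist_eq_enorm_sub]

end CadlagVersion

end StochasticCurves

theorem mainTheorem1 {Ω : Type*} {mΩ : MeasurableSpace Ω} (P : Measure Ω) [IsProbabilityMeasure P]
    (𝓕 : Filtration ℝ≥0 mΩ) (h𝓕 : StochasticCurves.UsualConditions P 𝓕)
    {H : Type*} [NormedAddCommGroup H] [InnerProductSpace ℝ H] [CompleteSpace H]
    [TopologicalSpace.SeparableSpace H]
    (M : ℝ≥0 → Ω → ℝ) (hM : StochasticCurves.IsSqIntegrableLevyMartingale P 𝓕 M)
    (T : ℝ≥0) (Φ : C(Icc (0 : ℝ≥0) T, Lp H 2 P)) (hΦ : Φ ∈ StochasticCurves.Cad P 𝓕 H T) :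
    -- a predictable version of `Φ` exists
    (∃ Ψ : ℝ≥0 → Ω → H, IsStronglyPredictable 𝓕 Ψ ∧ StochasticCurves.IsVersion Ψ Φ) ∧
    -- `Y = (G-)(Φ · M)` exists, is unique and lies in `C_ad[0,T]`
    ∃ Y ∈ StochasticCurves.Cad P 𝓕 H T,
      (∀ Z : Icc (0 : ℝ≥0) T → Lp H 2 P, StochasticCurves.IsGIntegral M Φ Z ↔ Z = Y) ∧
      -- for every predictable version `Ψ` of `Φ`, the integral `Ψ · M` exists and is a version of `Y`
      (∀ Ψ : ℝ≥0 → Ω → H, IsStronglyPredictable 𝓕 Ψ → StochasticCurves.IsVersion Ψ Φ →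
        (∃ I : ℝ≥0 → Ω → H, StochasticCurves.IsItoIntegral P 𝓕 M T Ψ I) ∧
        ∀ I : ℝ≥0 → Ω → H, StochasticCurves.IsItoIntegral P 𝓕 M T Ψ I →
          StochasticCurves.IsVersion I Y) ∧
      -- `Y` has an adapted càdlàg version
      ∃ J : ℝ≥0 → Ω → H, (∀ t ∈ Icc (0 : ℝ≥0) T, StronglyMeasurable[𝓕 t] (J t)) ∧
        (∀ ω, StochasticCurves.CadlagOn (fun t ↦ J t ω) (Icc (0 : ℝ≥0) T)) ∧
        StochasticCurves.IsVersion J Y := by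
  obtain ⟨Ψ, hΨ, hΨΦ⟩ := StochasticCurves.exists_predictable_version hΦ
  obtain ⟨Y, hYad, hY⟩ := StochasticCurves.exists_integral_curve hM hΦ
  have hYG := StochasticCurves.isGIntegral_of_hasCurveIntegral hM hΦ hY
  -- The Itô integral of one predictable version already serves as the càdlàg version of Y.
  obtain ⟨J, hJ⟩ := StochasticCurves.exists_isItoIntegral h𝓕 hM hΦ hΨ hΨΦ
  refine ⟨⟨Ψ, hΨ, hΨΦ⟩, Y, hYad, fun Z ↦ ⟨fun hZ ↦ hZ.unique hM hΦ hYG, ?_⟩,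
    fun Ψ' hΨ' hΨΦ' ↦ ⟨StochasticCurves.exists_isItoIntegral h𝓕 hM hΦ hΨ' hΨΦ',
      fun I hI ↦ hI.isVersion hM hY hΨΦ'⟩, J, hJ.2.1, hJ.2.2.1, hJ.isVersion hM hY hΨΦ⟩
  rintro rfl
  exact hYG
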